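/- **Setting.** A dataset $\mathcal S=\{(u,S_u)\}$ consists of finitely many users $u$, each holding a finite set $S_u$ of items from an arbitrary (possibly infinite) universe $\Sigma$. Two datasets are neighboring if one is obtained from the other by removing one user together with that user's set. A randomized algorithm $\mathcal M$ that outputs a finite subset of $\Sigma$ is $(\varepsilon,\delta)$-DP if $\Pr(\mathcal M(\mathcal S)\in\mathcal O)\le e^{\varepsilon}\Pr(\mathcal M(\mathcal S')\in\mathcal O)+\delta$ for all neighboring $\mathcal S,\mathcal S'$ and all sets $\mathcal O$ of possible outputs. Let $\Phi$ be the standard Gaussian distribution function. **Meta-algorithm.** Let $\varepsilon>0$, $\delta\in(0,1]$, let $\Delta_0\ge 1$ be an integer, let $\mathrm{ALG}$ be a weighting algorithm (a map from datasets to real weights on items) and let $h:\mathbb N\to\mathbb R$. Let $\sigma>0$ be any scale with $$\Phi\Big(\tfrac1{2\sigma}-\varepsilon\sigma\Big)-e^{\varepsilon}\,\Phi\Big(-\tfrac1{2\sigma}-\varepsilon\sigma\Big)\le\tfrac{\delta}{2},$$ and put $$\rho=\max_{1\le t\le\Delta_0}\Big(h(t)+\sigma\,\Phi^{-1}\big((1-\tfrac{\delta}{2})^{1/t}\big)\Big).$$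 Replace, independently for each user with $|S_u|>\Delta_0$, the set $S_u$ by a uniformly random subset of it of size $\Delta_0$. Let $\mathcal U$ be the union of the resulting sets and let $w$ be the weights that $\mathrm{ALG}$ computes from the resulting dataset. Add independent $\mathcal N(0,\sigma^2)$ noise to each $w(i)$, $i\in\mathcal U$, and release the set $U$ of those $i\in\mathcal U$ whose noisy weight is at least $\rho$. **Weighting algorithms.** The basic uniform weighting is $w(i)=\sum_{u:\,i\in S_u}|S_u|^{-1/2}$. Unbiased MAD has a real parameter $d_{\max}>1$ and an adaptive threshold $\tau$. Put $\alpha=1-\frac1{2\sqrt{d_{\max}}}$ and $I=\{u:1\le|S_u|\le d_{\max}\}$, and let $$w_{\rm init}(i)=\sum_{u\in I:\,i\in S_u}\frac1{|S_u|},\qquad r(i)=\max\Big\{0,\frac{w_{\rm init}(i)-\tau}{w_{\rm init}(i)}\Big\}\ \ (r(i)=0\text{ if }w_{\rm init}(i)=0),\qquad e_u=\frac1{|S_u|}\sum_{i\in S_u}r(i).$$ The MAD weight of item $i$ is $$w(i)=\min\{w_{\rm init}(i),\tau\}+\sum_{u\in I:\,i\in S_u}\frac{\alpha e_u}{d_{\max}}+\sum_{u\in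 I:\,i\in S_u}\Big(\frac1{\sqrt{|S_u|}}-\frac1{|S_u|}\Big)+\sum_{u\notin I:\,i\in S_u}\frac1{\sqrt{|S_u|}}.$$ **Corollary 5.2 (Privacy of MAD).** Let $\varepsilon>0$, $\delta\in(0,1]$, $\Delta_0\ge1$, $d_{\max}>1$, $\beta\ge0$ and $h(t)=1/\sqrt t$, and let $\sigma$ and $\rho$ be as in the meta-algorithm. Then releasing the set $U$ output by the meta-algorithm with unbiased MAD, with adaptive threshold $\tau=\rho+\beta\sigma$, as the weighting algorithm is $(\varepsilon,\delta)$-DP. The noise scale $\sigma$ and the threshold $\rho$ are exactly those of the basic algorithm: with the same $h$, $\sigma$ and $\rho$, the meta-algorithm with the basic uniform weighting is $(\varepsilon,\delta)$-DP as well. -/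

import Mathlib

open MeasureTheory ProbabilityTheory
open scoped ENNReal

noncomputable section

namespace PartitionSelection

/-! ### Datasets, neighbouring datasets, differential privacy -/

/-- A dataset `{(u, S_u)}`: finitely many users `u ∈ users`, each holding a finite set `items u` of
items. The values of `items` outside `users` are never read. -/
structure Dataset (User Item : Type*) where
  users : Finset User
  items : User → Finset Item

/-- `S'` is `S` together with one new user `v` (and the set of that user). -/
def AddsUser {User Item : Type*} (S S' : Dataset User Item) : Prop :=
  ∃ (v : User) (hv : v ∉ S.users),
    S'.users = Finset.cons v S.users hv ∧ ∀ u ∈ S.users, S'.items u = S.items u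

/-- One dataset is obtained from the other by removing a single user. -/
def Neighboring {User Item : Type*} (S S' : Dataset User Item) : Prop :=
  AddsUser S S' ∨ AddsUser S' S

/-- The possible outputs: finite sets of items. -/
def Output (Item : Type*) : Type _ := Finset Item

/-- Every set of possible outputs is an event. -/
instance outputMeasurableSpace (Item : Type*) : MeasurableSpace (Output Item) := ⊤

/-- `(ε, δ)`-differential privacy of a randomized algorithm `M`, given by its output law
on each dataset. -/
def IsDP {User Item : Type*} (ε δ : ℝ) (M : Dataset User Item → Measure (Output Item)) : Prop :=
  ∀ S S' : Dataset User Item, Neighboring S S' → ∀ O : Set (Output Item),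
    M S O ≤ ENNReal.ofReal (Real.exp ε) * M S' O + ENNReal.ofReal δ

/-! ### Noise scale and threshold -/

/-- The standard Gaussian cumulative distribution function `Φ`. -/
def gaussianCDF (x : ℝ) : ℝ := cdf (gaussianReal 0 1) x

/-- The quantile function of the standard Gaussian, which on `(0, 1)` is the inverse of `Φ`. -/
def gaussianQuantile (p : ℝ) : ℝ := sInf {x : ℝ | p ≤ gaussianCDF x}

/-- `σ` is an admissible standard deviation of the Gaussian mechanism
for `(ε, δ)`-privacy at `ℓ₂` sensitivity `Δ₂`. -/
def IsGaussianScale (ε δ Δ₂ σ : ℝ) : Prop :=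
  0 < σ ∧
    gaussianCDF (Δ₂ / (2 * σ) - ε * σ / Δ₂)
      - Real.exp ε * gaussianCDF (-(Δ₂ / (2 * σ)) - ε * σ / Δ₂) ≤ δ

/-- The threshold `ρ = max_{1 ≤ t ≤ Δ₀} (h t + σ Φ⁻¹((1 - δ/2)^{1/t}))`. -/
def threshold (h : ℕ → ℝ) (δ : ℝ) (Δ₀ : ℕ) (σ : ℝ) : ℝ :=
  sSup ((fun t : ℕ => h t + σ * gaussianQuantile ((1 - δ / 2) ^ (1 / (t : ℝ)))) '' Set.Icc 1 Δ₀)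

/-! ### The weight-and-threshold meta-algorithm -/

section Meta

variable {User Item : Type*}

open Classical in
/-- The union `𝒰` of the users' sets. -/
def Dataset.union (S : Dataset User Item) : Finset Item := S.users.biUnion S.items

/-- The possible results of subsampling a set to at most `Δ₀` items: the set itself if it has at
most `Δ₀` items, and otherwise its subsets with exactly `Δ₀` items. -/
def capChoices (Δ₀ : ℕ) (A : Finset Item) : Finset (Finset Item) :=
  A.powersetCard (min A.card Δ₀)

open Classical in
/-- All ways to cap the sets of all users, one subsample for each user. -/
def cappings (Δ₀ : ℕ) (S : Dataset User Item) : Finset (∀ u ∈ S.users, Finset Item) :=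
  S.users.pi fun u => capChoices Δ₀ (S.items u)

open Classical in
/-- The dataset that results from a choice of subsamples. -/
def Dataset.capped (S : Dataset User Item) (f : ∀ u ∈ S.users, Finset Item) :
    Dataset User Item where
  users := S.users
  items u := if hu : u ∈ S.users then f u hu else ∅

/-- Independent `N(0, σ²)` noise on finitely many items. -/
def noise (σ : ℝ) (V : Finset Item) : Measure (V → ℝ) :=
  Measure.pi fun _ => gaussianReal 0 (Real.toNNReal (σ ^ 2))

open Classical in
/-- The items of `V` whose noisy weight `w i + z i` is at least `ρ`. -/
def released (w : Item → ℝ) (ρ : ℝ) (V : Finset Item) (z : V → ℝ) : Output Item :=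
  (Finset.univ.filter fun i : V => ρ ≤ w i + z i).map (Function.Embedding.subtype (· ∈ V))

/-- The law of the released set when the weights `w` of the items in `V` are perturbed by
independent `N(0, σ²)` noise and thresholded at `ρ`. -/
def thresholdLaw (w : Item → ℝ) (σ ρ : ℝ) (V : Finset Item) : Measure (Output Item) :=
  (noise σ V).map (released w ρ V)

/-- The law of the set `U` released by the meta-algorithm with weighting algorithm `ALG`. The sets
of the users are subsampled independently and uniformly, so the vector of subsamples is uniform
over `cappings Δ₀ S` and independent of the noise; the law of `U` is the average
over these vectors. After the capping, `ALG` and the union of the sets are those of the capped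
dataset. -/
def weightAndThreshold (ALG : Dataset User Item → Item → ℝ) (h : ℕ → ℝ) (δ : ℝ) (Δ₀ : ℕ)
    (σ : ℝ) (S : Dataset User Item) : Measure (Output Item) :=
  ((cappings Δ₀ S).card : ℝ≥0∞)⁻¹ •
    ∑ f ∈ cappings Δ₀ S,
      thresholdLaw (ALG (S.capped f)) σ (threshold h δ Δ₀ σ) (S.capped f).union

end Meta

/-! ### Weighting algorithms -/

section Weights

variable {User Item : Type*}

open Classical in
/-- Uniform weighting: every user adds `1 / √|S_u|` to each of its items. -/
def basic (S : Dataset User Item) (i : Item) : ℝ :=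
  ∑ u ∈ S.users with i ∈ S.items u, 1 / √((S.items u).card : ℝ)

/-- The reroute discount factor `α` for minimum bias `1`. -/
def rerouteFactor (dmax : ℝ) : ℝ := 1 - 1 / (2 * √dmax)

open Classical in
/-- The adaptive users: those with `1 ≤ |S_u| ≤ dmax`. -/
def adaptiveUsers (dmax : ℝ) (S : Dataset User Item) : Finset User :=
  {u ∈ S.users | 1 ≤ (S.items u).card ∧ ((S.items u).card : ℝ) ≤ dmax}

open Classical in
/-- Initial weights: every adaptive user adds `1 / |S_u|` to each of its items. -/
def initWeight (dmax : ℝ) (S : Dataset User Item) (i : Item) : ℝ :=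
  ∑ u ∈ adaptiveUsers dmax S with i ∈ S.items u, 1 / ((S.items u).card : ℝ)

/-- The fraction of the initial weight of `i` above the adaptive threshold `τ`; it is `0` for an
item without initial weight. -/
def excessRatio (τ dmax : ℝ) (S : Dataset User Item) (i : Item) : ℝ :=
  max 0 ((initWeight dmax S i - τ) / initWeight dmax S i)

/-- Initial weights truncated at `τ`. -/
def truncWeight (τ dmax : ℝ) (S : Dataset User Item) (i : Item) : ℝ :=
  min (initWeight dmax S i) τ

/-- The excess weight returned to user `u`. -/
def userExcess (τ dmax : ℝ) (S : Dataset User Item) (u : User) : ℝ :=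
  1 / ((S.items u).card : ℝ) * ∑ i ∈ S.items u, excessRatio τ dmax S i

open Classical in
/-- The rerouted weight: every adaptive user adds `α e_u / dmax` to each of its items. -/
def rerouteWeight (τ dmax : ℝ) (S : Dataset User Item) (i : Item) : ℝ :=
  ∑ u ∈ adaptiveUsers dmax S with i ∈ S.items u,
    rerouteFactor dmax * userExcess τ dmax S u / dmax

open Classical in
/-- The unbiased MaxAdaptiveDegree weighting: truncated plus rerouted weight; adaptive users then
add `1 / √|S_u| - 1 / |S_u|` to each of their items, the other users add `1 / √|S_u|`. -/
def unbiasedMAD (τ dmax : ℝ) (S : Dataset User Item) (i : Item) : ℝ :=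
  truncWeight τ dmax S i + rerouteWeight τ dmax S i
    + ∑ u ∈ adaptiveUsers dmax S with i ∈ S.items u,
        (1 / √((S.items u).card : ℝ) - 1 / ((S.items u).card : ℝ))
    + ∑ u ∈ S.users \ adaptiveUsers dmax S with i ∈ S.items u, 1 / √((S.items u).card : ℝ)

end Weights

/-! ### The output law is a probability measure -/

section Sanity

variable {User Item : Type*}

theorem measurable_released (w : Item → ℝ) (ρ : ℝ) (V : Finset Item) :
    Measurable (released w ρ V) := by
  classical
  let g : Set V → Output Item := fun b =>
    (Finset.univ.filter fun i : V => i ∈ b).map (Function.Embedding.subtype (· ∈ V))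
  have h1 : Measurable fun z : V → ℝ => {i : V | ρ ≤ w i + z i} := by
    refine measurable_set_iff.2 fun i => ?_
    exact measurableSet_setOfPred.1
      (measurableSet_le measurable_const (measurable_const.add (measurable_pi_apply i)))
  have h2 : released w ρ V = g ∘ fun z : V → ℝ => {i : V | ρ ≤ w i + z i} := by
    funext z
    simp only [released, g, Function.comp]
    congr
  rw [h2]
  exact (measurable_of_finite g).comp h1

instance (w : Item → ℝ) (σ ρ : ℝ) (V : Finset Item) :
    IsProbabilityMeasure (thresholdLaw w σ ρ V) := by
  have : IsProbabilityMeasure (noise σ V) := by unfold noise; infer_instance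
  exact Measure.isProbabilityMeasure_map (measurable_released w ρ V).aemeasurable

instance (ALG : Dataset User Item → Item → ℝ) (h : ℕ → ℝ) (δ : ℝ) (Δ₀ : ℕ) (σ : ℝ)
    (S : Dataset User Item) : IsProbabilityMeasure (weightAndThreshold ALG h δ Δ₀ σ S) := by
  classical
  have hne : (cappings Δ₀ S).card ≠ 0 := by
    rw [cappings, Finset.card_pi, Finset.prod_ne_zero_iff]
    intro u _
    rw [capChoices, Finset.card_powersetCard]
    exact (Nat.choose_pos (min_le_left _ _)).ne'
  constructor
  simp only [weightAndThreshold, Measure.smul_apply, Measure.finsetSum_apply, measure_univ,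
    Finset.sum_const, smul_eq_mul, nsmul_eq_mul, mul_one]
  exact ENNReal.inv_mul_cancel (by exact_mod_cast hne) (ENNReal.natCast_ne_top _)

/-- An admissible noise scale always exists. -/
theorem exists_isGaussianScale (ε δ : ℝ) (hε : 0 < ε) (hδ : 0 < δ) :
    ∃ σ, IsGaussianScale ε δ 1 σ := by
  have hlim : Filter.Tendsto (fun σ : ℝ => 1 / (2 * σ) - ε * σ / 1) Filter.atTop Filter.atBot := by
    have a : Filter.Tendsto (fun σ : ℝ => (1 / 2) * σ⁻¹) Filter.atTop (nhds ((1 / 2) * 0)) :=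
      tendsto_inv_atTop_zero.const_mul _
    have b : Filter.Tendsto (fun σ : ℝ => -(ε * σ)) Filter.atTop Filter.atBot :=
      Filter.tendsto_neg_atTop_atBot.comp (Filter.tendsto_id.const_mul_atTop hε)
    refine (a.add_atBot b).congr fun σ => ?_
    rw [div_one, one_div, one_div, mul_inv]
    ring
  have hc := (tendsto_cdf_atBot (gaussianReal 0 1)).comp hlim
  obtain ⟨σ, h1, h2⟩ := ((hc.eventually (gt_mem_nhds hδ)).and (Filter.eventually_gt_atTop 0)).exists
  refine ⟨σ, h2, ?_⟩
  have h3 : 0 ≤ Real.exp ε * gaussianCDF (-(1 / (2 * σ)) - ε * σ / 1) :=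
    mul_nonneg (Real.exp_pos _).le (cdf_nonneg _ _)
  have h4 : gaussianCDF (1 / (2 * σ) - ε * σ / 1) < δ := h1
  linarith

end Sanity

end PartitionSelection

end

namespace PartitionSelection

open scoped NNReal

/-! ### The Gaussian mechanism -/


/-! Privacy reduces to two deterministic facts about a weighting when one user `v` joins: the
weights of the old items move by at most 1 in ℓ₂ norm, and if `v` brings `t` novel items, each of
them has weight at most `h t`. Coupling the subsamples of the common users makes the capped datasets
neighbouring, with at most `Δ₀` novel items. The noise on the old items is then a Gaussian mechanism
costing `δ / 2`. The threshold suppresses all novel items at once, independently of the old ones,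
except with probability `δ / 2`; when they are suppressed, both datasets release the same function
of the old noisy weights (`thresholdLaw_le_both`).

For the basic weighting both facts are immediate. For MAD, let `v` be adaptive with `k` items, and
let `T` be the part of its initial weight that truncation removes. Excess is conserved
(`AddsUserAt.sum_excessGrowth`): the excesses of all adaptive users grow by `T` in total. So
rerouting adds at most `α T / dmax` to any item and at most `α T` overall, while the direct
contribution of `v` shrinks by `T`. The factor `α` is chosen so that the loss in squared norm pays
for the gain (`sum_sq_add_le_one`).

Since `τ ≥ 1`, novel items are never truncated. Only the other `k - t` items of `v` can produce
excess, and the little that returns fits into the gap between `1 / √k` and `1 / √t`. -/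

/-- Neyman–Pearson: among all events, the likelihood ratio event `{c < L}` is the worst one for a
bound `P A ≤ c Q A + δ`. -/
theorem withDensity_le_of_likelihoodRatio {Ω : Type*} [MeasurableSpace Ω] (Q : Measure Ω)
    [IsFiniteMeasure Q] {L : Ω → ℝ≥0∞} (hL : Measurable L) {c δ : ℝ≥0∞} (hc : c ≠ ∞)
    (h : Q.withDensity L {x | c < L x} ≤ c * Q {x | c < L x} + δ)
    {A : Set Ω} (hA : MeasurableSet A) : Q.withDensity L A ≤ c * Q A + δ := by
  set P := Q.withDensity L with hP
  set B := {x | c < L x} with hB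
  have mB : MeasurableSet B := measurableSet_lt measurable_const hL
  have h1 : P (A \ B) ≤ c * Q (A \ B) := by
    rw [hP, withDensity_apply _ (hA.diff mB), ← setLIntegral_const]
    refine setLIntegral_mono measurable_const fun x hx => ?_
    exact not_lt.1 hx.2
  have h2 : c * Q (B \ A) ≤ P (B \ A) := by
    rw [hP, withDensity_apply _ (mB.diff hA), ← setLIntegral_const]
    exact setLIntegral_mono hL fun x hx => le_of_lt hx.1
  have e1 := measure_inter_add_sdiff (μ := P) A mB
  have e2 := measure_inter_add_sdiff (μ := P) B hA
  have e3 := measure_inter_add_sdiff (μ := Q) A mB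
  have e4 := measure_inter_add_sdiff (μ := Q) B hA
  rw [Set.inter_comm] at e2 e4
  have hfin : c * Q (B \ A) ≠ ∞ := ENNReal.mul_ne_top hc (measure_ne_top _ _)
  -- `P - c Q` is nonnegative on `B \ A`, so dropping that piece from `B` only helps. Adding the
  -- finite `c * Q (B \ A)` to both sides avoids truncated subtraction.
  have h3 : P (A ∩ B) ≤ c * Q (A ∩ B) + δ := by
    refine (ENNReal.add_le_add_iff_right hfin).1 ?_
    calc P (A ∩ B) + c * Q (B \ A) ≤ P (A ∩ B) + P (B \ A) := by gcongr
      _ = P B := e2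
      _ ≤ c * Q B + δ := h
      _ = c * Q (A ∩ B) + δ + c * Q (B \ A) := by rw [← e4]; ring
  calc P A = P (A ∩ B) + P (A \ B) := e1.symm
    _ ≤ (c * Q (A ∩ B) + δ) + c * Q (A \ B) := by gcongr
    _ = c * Q A + δ := by rw [← e3]; ring

/-- A change of mean of a Gaussian is a change of density. -/
theorem gaussianReal_eq_withDensity (a b : ℝ) {v : ℝ≥0} (hv : v ≠ 0) :
    gaussianReal a v = (gaussianReal b v).withDensity fun x =>
      ENNReal.ofReal (Real.exp ((a - b) * (x - b) / v - (a - b) ^ 2 / (2 * v))) := by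
  have hv' : (v : ℝ) ≠ 0 := by exact_mod_cast hv
  rw [gaussianReal_of_var_ne_zero _ hv, gaussianReal_of_var_ne_zero _ hv,
    ← withDensity_mul _ (measurable_gaussianPDF b v) (by fun_prop)]
  congr 1
  funext x
  simp only [Pi.mul_apply, gaussianPDF, gaussianPDFReal]
  rw [← ENNReal.ofReal_mul (by positivity), mul_assoc _ (Real.exp _), ← Real.exp_add]
  congr 3
  field_simp
  ring

/-- A product of measures with densities has the product density. -/
theorem pi_withDensity_prod {ι : Type*} [Fintype ι] (μ ν : ι → Measure ℝ)
    [∀ i, IsProbabilityMeasure (μ i)] [∀ i, SigmaFinite (ν i)] {L : ι → ℝ → ℝ≥0∞}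
    (hL : ∀ i, Measurable (L i)) (h : ∀ i, ν i = (μ i).withDensity (L i)) :
    Measure.pi ν = (Measure.pi μ).withDensity fun z => ∏ i, L i (z i) := by
  refine Measure.pi_eq fun s hs => ?_
  -- With each indicator absorbed into its own factor, the integral over a box is the expectation of
  -- a product of independent variables.
  have key := lintegral_prod_eq_prod_lintegral_of_indepFun (μ := Measure.pi μ) Finset.univ
    (fun i z => (s i).indicator (L i) (z i))
    (iIndepFun_pi fun i => ((hL i).indicator (hs i)).aemeasurable)
    (fun i => ((hL i).indicator (hs i)).comp (measurable_pi_apply i))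
  rw [withDensity_apply _ (MeasurableSet.univ_pi hs),
    ← lintegral_indicator (MeasurableSet.univ_pi hs)]
  trans ∫⁻ z, ∏ i, (s i).indicator (L i) (z i) ∂Measure.pi μ
  · refine lintegral_congr fun z => ?_
    by_cases hz : z ∈ Set.univ.pi s
    · rw [Set.indicator_of_mem hz]
      exact Finset.prod_congr rfl fun i _ => (Set.indicator_of_mem (hz i trivial) _).symm
    · rw [Set.indicator_of_notMem hz]
      obtain ⟨i, hi⟩ : ∃ i, z i ∉ s i := by simpa using hz
      exact (Finset.prod_eq_zero (Finset.mem_univ i) (Set.indicator_of_notMem hi _)).symm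
  · rw [key]
    refine Finset.prod_congr rfl fun i _ => ?_
    rw [h i, withDensity_apply _ (hs i), ← lintegral_indicator (hs i)]
    exact (measurePreserving_eval μ i).lintegral_comp ((hL i).indicator (hs i))

theorem pi_gaussianReal_eq_withDensity {ι : Type*} [Fintype ι] (a b : ι → ℝ) {v : ℝ≥0}
    (hv : v ≠ 0) :
    Measure.pi (fun i => gaussianReal (a i) v) =
      (Measure.pi fun i => gaussianReal (b i) v).withDensity fun z =>
        ENNReal.ofReal (Real.exp
          ((∑ i, (a i - b i) * (z i - b i)) / v - (∑ i, (a i - b i) ^ 2) / (2 * v))) := by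
  rw [pi_withDensity_prod (fun i => gaussianReal (b i) v) (fun i => gaussianReal (a i) v)
    (fun i => by fun_prop) fun i => gaussianReal_eq_withDensity (a i) (b i) hv]
  congr 1
  funext z
  rw [← ENNReal.ofReal_prod_of_nonneg fun i _ => (Real.exp_pos _).le, ← Real.exp_sum,
    Finset.sum_sub_distrib, Finset.sum_div, Finset.sum_div]

/-- Linear functionals of independent Gaussians are Gaussian. -/
theorem pi_gaussianReal_map_sum_mul {ι : Type*} [Fintype ι] (c m : ι → ℝ) (v : ℝ≥0)
    (hc : ∑ i, c i ^ 2 = 1) :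
    (Measure.pi fun i => gaussianReal (m i) v).map (fun z => ∑ i, c i * z i) =
      gaussianReal (∑ i, c i * m i) v := by
  have h0 : (Measure.pi fun i => gaussianReal (m i) v).map (fun z => ∑ i, c i * z i) =
      (Measure.pi fun i => (gaussianReal (m i) v).map (c i * ·)).map (fun z => ∑ i, z i) := by
    rw [← Measure.pi_map_pi fun i => by fun_prop, Measure.map_map (by fun_prop) (by fun_prop)]
    rfl
  rw [h0]
  refine Measure.ext_of_charFun ?_
  have : ∀ i, IsProbabilityMeasure ((gaussianReal (m i) v).map (c i * ·)) := fun i =>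
    Measure.isProbabilityMeasure_map (by fun_prop)
  rw [charFun_map_sum_pi_eq_prod]
  funext t
  simp_rw [Finset.prod_apply, gaussianReal_map_const_mul, charFun_gaussianReal, ← Complex.exp_sum]
  congr 1
  have hc' : (∑ i, (c i : ℂ) ^ 2) = 1 := by exact_mod_cast hc
  rw [Finset.sum_sub_distrib]
  congr 1
  · push_cast
    rw [Finset.mul_sum, Finset.sum_mul]
  · rw [← Finset.sum_div, ← Finset.sum_mul]
    push_cast
    change (∑ i, ((c i : ℂ) ^ 2 * v)) * _ / 2 = _
    rw [← Finset.sum_mul, hc', one_mul]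

theorem gaussianReal_Iic_eq (m : ℝ) {σ : ℝ} (hσ : 0 < σ) (s : ℝ) :
    gaussianReal m (Real.toNNReal (σ ^ 2)) (Set.Iic s) =
      ENNReal.ofReal (gaussianCDF ((s - m) / σ)) := by
  have e : gaussianReal m (Real.toNNReal (σ ^ 2)) =
      (gaussianReal 0 1).map (fun x => σ * x + m) := by
    have h1 := gaussianReal_map_const_mul (μ := 0) (v := 1) σ
    have h2 := gaussianReal_map_add_const (μ := σ * 0) (v := NNReal.mk (σ ^ 2) (sq_nonneg _) * 1) m
    rw [← h1, Measure.map_map (by fun_prop) (by fun_prop)] at h2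
    rw [show (fun x => σ * x + m) = (fun x => x + m) ∘ (σ * ·) from rfl, h2]
    congr 1
    · ring
    · rw [mul_one]; exact Real.toNNReal_of_nonneg _
  rw [e, Measure.map_apply (by fun_prop) measurableSet_Iic, gaussianCDF,
    ofReal_cdf]
  congr 1
  ext x
  simp only [Set.mem_preimage, Set.mem_Iic]
  rw [le_div_iff₀ hσ]
  constructor <;> intro h <;> linarith

theorem gaussianReal_Ioi_eq (m : ℝ) {σ : ℝ} (hσ : 0 < σ) (s : ℝ) :
    gaussianReal m (Real.toNNReal (σ ^ 2)) (Set.Ioi s) =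
      ENNReal.ofReal (gaussianCDF ((m - s) / σ)) := by
  have hv : Real.toNNReal (σ ^ 2) ≠ 0 := by
    rw [Ne, Real.toNNReal_eq_zero, not_le]; positivity
  have := nullSingletonClass_gaussianReal (μ := -m) hv
  rw [show (m - s) / σ = (-s - -m) / σ by ring, ← gaussianReal_Iic_eq _ hσ, ← gaussianReal_map_neg,
    Measure.map_apply (by fun_prop) measurableSet_Iic]
  rw [← gaussianReal_map_neg] at this
  have e : (fun x : ℝ => -x) ⁻¹' Set.Iic (-s) = Set.Ici s := by ext; simp
  have := nullSingletonClass_gaussianReal (μ := m) hv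
  rw [e, Ioi_ae_eq_Ici.measure_eq]

/-- The log-likelihood ratio depends on `z` only through `⟨a - b, z⟩`, which has variance `σ ^ 2`.
It exceeds `ε` exactly on the half-space `⟨a - b, z⟩ > s + ε σ² + 1/2`, whose two probabilities are
the two terms of `IsGaussianScale`. Neyman–Pearson passes from this half-space to all events. -/
theorem pi_gaussianReal_le_of_unit {ι : Type*} [Fintype ι] {ε δ σ : ℝ}
    (hδ : 0 ≤ δ) (hσ : IsGaussianScale ε δ 1 σ) (a b : ι → ℝ) (hab : ∑ i, (a i - b i) ^ 2 = 1)
    {A : Set (ι → ℝ)} (hA : MeasurableSet A) :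
    Measure.pi (fun i => gaussianReal (a i) (Real.toNNReal (σ ^ 2))) A ≤
      ENNReal.ofReal (Real.exp ε) *
        Measure.pi (fun i => gaussianReal (b i) (Real.toNNReal (σ ^ 2))) A + ENNReal.ofReal δ := by
  obtain ⟨hpos, hsc⟩ := hσ
  have hv : Real.toNNReal (σ ^ 2) ≠ 0 := by
    rw [Ne, Real.toNNReal_eq_zero, not_le]; positivity
  have hvr : ((Real.toNNReal (σ ^ 2) : ℝ≥0) : ℝ) = σ ^ 2 := Real.coe_toNNReal _ (by positivity)
  set s : ℝ := ∑ i, (a i - b i) * b i with hs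
  have hsa : ∑ i, (a i - b i) * a i = s + 1 := by
    rw [hs, ← hab, ← Finset.sum_add_distrib]
    exact Finset.sum_congr rfl fun i _ => by ring
  have law : ∀ m : ι → ℝ,
      Measure.pi (fun i => gaussianReal (m i) (Real.toNNReal (σ ^ 2)))
        ((fun z => ∑ i, (a i - b i) * z i) ⁻¹' Set.Ioi (s + ε * σ ^ 2 + 1 / 2)) =
      ENNReal.ofReal (gaussianCDF
        ((∑ i, (a i - b i) * m i - (s + ε * σ ^ 2 + 1 / 2)) / σ)) := fun m => by
    rw [← gaussianReal_Ioi_eq _ hpos, ← pi_gaussianReal_map_sum_mul _ _ _ hab,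
      Measure.map_apply (by fun_prop) measurableSet_Ioi]
  have hwd := pi_gaussianReal_eq_withDensity a b hv
  rw [hwd]
  refine withDensity_le_of_likelihoodRatio _ (by fun_prop) ENNReal.ofReal_ne_top ?_ hA
  rw [← hwd]
  have hset : {x : ι → ℝ | ENNReal.ofReal (Real.exp ε) < ENNReal.ofReal (Real.exp
          ((∑ i, (a i - b i) * (x i - b i)) / (Real.toNNReal (σ ^ 2) : ℝ≥0)
            - (∑ i, (a i - b i) ^ 2) / (2 * (Real.toNNReal (σ ^ 2) : ℝ≥0))))} =
      (fun z => ∑ i, (a i - b i) * z i) ⁻¹' Set.Ioi (s + ε * σ ^ 2 + 1 / 2) := by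
    ext x
    simp only [Set.mem_ofPred_eq, Set.mem_preimage, Set.mem_Ioi]
    rw [ENNReal.ofReal_lt_ofReal_iff (Real.exp_pos _), Real.exp_lt_exp, hvr, hab]
    simp_rw [mul_sub]
    rw [Finset.sum_sub_distrib]
    rw [← hs, div_sub_div _ _ (by positivity) (by positivity), lt_div_iff₀ (by positivity)]
    constructor
    · intro h
      have : σ ^ 2 * (2 * (ε * σ ^ 2)) < σ ^ 2 * (2 * (∑ i, (a i - b i) * x i - s) - 1) := by
        linarith
      have := lt_of_mul_lt_mul_left this (by positivity)
      linarith
    · intro h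
      have : 2 * (ε * σ ^ 2) < 2 * (∑ i, (a i - b i) * x i - s) - 1 := by linarith
      have := mul_lt_mul_of_pos_left this (show 0 < σ ^ 2 by positivity)
      linarith
  rw [hset, law, law, ← hs, hsa, ← ENNReal.ofReal_mul (Real.exp_pos _).le,
    ← ENNReal.ofReal_add (mul_nonneg (Real.exp_pos _).le (by exact cdf_nonneg _ _)) hδ]
  refine ENNReal.ofReal_le_ofReal ?_
  have e1 : (s + 1 - (s + ε * σ ^ 2 + 1 / 2)) / σ = 1 / (2 * σ) - ε * σ / 1 := by
    field_simp; ring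
  have e2 : (s - (s + ε * σ ^ 2 + 1 / 2)) / σ = -(1 / (2 * σ)) - ε * σ / 1 := by
    field_simp; ring
  rw [e1, e2]
  linarith

/-- The Gaussian mechanism: two mean vectors at `ℓ₂` distance at most `1`. -/
theorem pi_gaussianReal_le {ι : Type*} [Fintype ι] {ε δ σ : ℝ}
    (hδ : 0 ≤ δ) (hσ : IsGaussianScale ε δ 1 σ) (a b : ι → ℝ) (hab : ∑ i, (a i - b i) ^ 2 ≤ 1)
    {A : Set (ι → ℝ)} (hA : MeasurableSet A) :
    Measure.pi (fun i => gaussianReal (a i) (Real.toNNReal (σ ^ 2))) A ≤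
      ENNReal.ofReal (Real.exp ε) *
        Measure.pi (fun i => gaussianReal (b i) (Real.toNNReal (σ ^ 2))) A + ENNReal.ofReal δ := by
  -- pad with one coordinate, so that the distance becomes exactly `1`
  let x : ℝ := √(1 - ∑ i, (a i - b i) ^ 2)
  let ext (m : ι → ℝ) (y : ℝ) : Option ι → ℝ := fun o => o.elim y m
  have hmp : ∀ (m : ι → ℝ) (y : ℝ),
      Measure.pi (fun o => gaussianReal (ext m y o) (Real.toNNReal (σ ^ 2)))
        ((fun z i => z (some i)) ⁻¹' A) =
      Measure.pi (fun i => gaussianReal (m i) (Real.toNNReal (σ ^ 2))) A := fun m y => by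
    have hm : Measurable fun (z : Option ι → ℝ) (i : ι) => z (some i) := by fun_prop
    rw [← Measure.map_apply hm hA]
    congr 1
    refine (Measure.pi_eq fun s hs => ?_).symm
    rw [Measure.map_apply hm (MeasurableSet.univ_pi hs)]
    have e : (fun (z : Option ι → ℝ) (i : ι) => z (some i)) ⁻¹' Set.univ.pi s =
        Set.univ.pi fun o : Option ι => o.elim Set.univ s := by
      ext z
      simp [Set.mem_pi, Option.forall]
    rw [e, Measure.pi_pi, Fintype.prod_option]
    simp [ext]
  rw [← hmp a x, ← hmp b 0]
  refine pi_gaussianReal_le_of_unit hδ hσ _ _ ?_ (measurableSet_preimage (by fun_prop) hA)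
  rw [Fintype.sum_option]
  simp only [ext, Option.elim, x, sub_zero]
  rw [Real.sq_sqrt (by linarith)]
  ring

/-! ### Quantiles and the threshold -/

/-- Right-continuity of `Φ` keeps the bound at the infimum; `p < 1` makes the set nonempty. This
one-sided inequality is all that suppression needs from the quantile. -/
theorem le_gaussianCDF_gaussianQuantile {p : ℝ} (hp : p < 1) :
    p ≤ gaussianCDF (gaussianQuantile p) := by
  have hne : {x : ℝ | p ≤ gaussianCDF x}.Nonempty :=
    ((tendsto_cdf_atTop (gaussianReal 0 1)).eventually (le_mem_nhds hp)).exists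
  have hr : Filter.Tendsto gaussianCDF (nhdsWithin (gaussianQuantile p) (Set.Ioi _))
      (nhds (gaussianCDF (gaussianQuantile p))) :=
    (((cdf (gaussianReal 0 1)).right_continuous (gaussianQuantile p)).mono_left
      (nhdsWithin_mono _ Set.Ioi_subset_Ici_self))
  refine ge_of_tendsto hr ?_
  filter_upwards [self_mem_nhdsWithin] with x hx
  obtain ⟨y, hy, hyx⟩ := exists_lt_of_csInf_lt hne hx
  exact le_trans hy (monotone_cdf _ hyx.le)

/-- By symmetry the tails below `x` and above `-x` have equal mass, and the interval between them
has positive mass. -/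
theorem gaussianCDF_lt_half {x : ℝ} (hx : x < 0) : gaussianCDF x < 1 / 2 := by
  have h1 : ENNReal.ofReal (gaussianCDF x) = gaussianReal 0 1 (Set.Iic x) := ofReal_cdf _ _
  have h2 : ENNReal.ofReal (gaussianCDF x) = gaussianReal 0 1 (Set.Ioi (-x)) := by
    have := gaussianReal_Ioi_eq 0 one_pos (-x)
    rw [one_pow, Real.toNNReal_one] at this
    rw [this]
    simp
  have hpos : 0 < gaussianReal 0 1 (Set.Ioc x (-x)) := by
    rw [pos_iff_ne_zero]
    intro h0
    have := gaussianReal_absolutelyContinuous' 0 one_ne_zero h0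
    rw [Real.volume_Ioc, ENNReal.ofReal_eq_zero] at this
    linarith
  have hsum : gaussianReal 0 1 (Set.Iic x) + gaussianReal 0 1 (Set.Ioc x (-x))
      + gaussianReal 0 1 (Set.Ioi (-x)) = 1 := by
    rw [← measure_union (Set.Iic_disjoint_Ioc le_rfl) measurableSet_Ioc,
      Set.Iic_union_Ioc_eq_Iic (by linarith),
      ← measure_union (Set.Iic_disjoint_Ioi le_rfl) measurableSet_Ioi,
      Set.Iic_union_Ioi, measure_univ]
  rw [← h1, ← h2] at hsum
  have hfin : gaussianReal 0 1 (Set.Ioc x (-x)) ≠ ∞ := measure_ne_top _ _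
  rw [← ENNReal.ofReal_toReal hfin, ← ENNReal.ofReal_add (by exact cdf_nonneg _ _) ENNReal.toReal_nonneg,
    ← ENNReal.ofReal_add (add_nonneg (by exact cdf_nonneg _ _) ENNReal.toReal_nonneg)
      (by exact cdf_nonneg _ _), ENNReal.ofReal_eq_one] at hsum
  have := ENNReal.toReal_pos hpos.ne' hfin
  linarith

theorem gaussianQuantile_nonneg {p : ℝ} (hp : 1 / 2 ≤ p) : 0 ≤ gaussianQuantile p :=
  Real.sInf_nonneg fun _ hx => not_lt.1 fun h => absurd (gaussianCDF_lt_half h)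
    (not_lt.2 (hp.trans hx))

theorem le_threshold (h : ℕ → ℝ) (δ : ℝ) {Δ₀ : ℕ} (σ : ℝ) {t : ℕ} (ht : 1 ≤ t) (ht' : t ≤ Δ₀) :
    h t + σ * gaussianQuantile ((1 - δ / 2) ^ (1 / (t : ℝ))) ≤ threshold h δ Δ₀ σ :=
  le_csSup ((Set.finite_Icc 1 Δ₀).image _).bddAbove ⟨t, ⟨ht, ht'⟩, rfl⟩

/-- The term `t = 1` has quantile level `1 - δ / 2 ≥ 1 / 2`, so its noise margin is nonnegative.
This is the source of `τ ≥ 1` for MAD. -/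
theorem le_threshold_one (h : ℕ → ℝ) {δ : ℝ} (hδ : δ ≤ 1) {Δ₀ : ℕ} (hΔ₀ : 1 ≤ Δ₀) {σ : ℝ}
    (hσ : 0 < σ) : h 1 ≤ threshold h δ Δ₀ σ := by
  have h1 := le_threshold h δ σ le_rfl hΔ₀
  have h2 : 0 ≤ gaussianQuantile ((1 - δ / 2) ^ (1 / ((1 : ℕ) : ℝ))) :=
    gaussianQuantile_nonneg (by simp; linarith)
  nlinarith [mul_nonneg hσ.le h2]

/-! ### Releasing the items of a larger union -/

section

/-- The law of the noisy weights. -/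
noncomputable def noisyWeights {Item : Type*} (w : Item → ℝ) (σ : ℝ) (V : Finset Item) : Measure (V → ℝ) :=
  Measure.pi fun i => gaussianReal (w i) (Real.toNNReal (σ ^ 2))

variable {Item : Type*}

instance (w : Item → ℝ) (σ : ℝ) (V : Finset Item) : IsProbabilityMeasure (noisyWeights w σ V) := by
  unfold noisyWeights; infer_instance

/-- With the weights moved into the Gaussian means, the release map no longer depends on them, and
changing the weights changes only the measure. -/
theorem thresholdLaw_eq_map (w : Item → ℝ) (σ ρ : ℝ) (V : Finset Item) :
    thresholdLaw w σ ρ V = (noisyWeights w σ V).map (released 0 ρ V) := by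
  have h1 : noisyWeights w σ V = (noise σ V).map fun z (i : V) => w i + z i := by
    unfold noise noisyWeights
    rw [Measure.pi_map_pi (f := fun (i : V) (x : ℝ) => w i + x) fun i => by fun_prop]
    simp_rw [gaussianReal_map_const_add, zero_add]
  rw [h1, Measure.map_map (measurable_released _ _ _) (by fun_prop), thresholdLaw]
  congr 1
  funext z
  exact Finset.ext fun i => by simp [released]

theorem noisyWeights_map_restrict (w : Item → ℝ) (σ : ℝ) {V V' : Finset Item} (hV : V ⊆ V') :
    (noisyWeights w σ V').map (Finset.restrict₂ (π := fun _ => ℝ) hV) = noisyWeights w σ V :=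
  (isProjectiveMeasureFamily_pi (fun i : Item => gaussianReal (w i) (Real.toNNReal (σ ^ 2)))
    V' V hV).symm

theorem indepFun_restrict_noisyWeights (w : Item → ℝ) (σ : ℝ) {V N V' : Finset Item} (hV : V ⊆ V')
    (hN : N ⊆ V') (hVN : Disjoint V N) :
    IndepFun (Finset.restrict₂ (π := fun _ => ℝ) hV) (Finset.restrict₂ (π := fun _ => ℝ) hN)
      (noisyWeights w σ V') := by
  classical
  have h1 : iIndepFun (fun (i : V') (z : V' → ℝ) => z i) (noisyWeights w σ V') :=
    iIndepFun_pi (X := fun _ x => x) fun i => by fun_prop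
  have h2 := h1.indepFun_finset (V'.attach.filter fun i => i.1 ∈ V) (V'.attach.filter fun i => i.1 ∈ N)
    (by
      rw [Finset.disjoint_left]
      intro i hi hi'
      exact Finset.disjoint_left.1 hVN (Finset.mem_filter.1 hi).2 (Finset.mem_filter.1 hi').2)
    (fun i => by fun_prop)
  exact h2.comp
    (φ := fun y (i : V) => y ⟨⟨i, hV i.2⟩, Finset.mem_filter.2 ⟨Finset.mem_attach _ _, i.2⟩⟩)
    (ψ := fun y (i : N) => y ⟨⟨i, hN i.2⟩, Finset.mem_filter.2 ⟨Finset.mem_attach _ _, i.2⟩⟩)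
    (by fun_prop) (by fun_prop)

theorem released_eq_of_lt {ρ : ℝ} {V V' : Finset Item} (hV : V ⊆ V') {y : V' → ℝ}
    (hy : ∀ i : V', (i : Item) ∉ V → y i < ρ) :
    released 0 ρ V' y = released 0 ρ V (Finset.restrict₂ (π := fun _ => ℝ) hV y) := by
  refine Finset.ext fun i => ?_
  simp only [released, Finset.mem_map, Finset.mem_filter, Finset.mem_univ, true_and, Pi.zero_apply,
    zero_add, Function.Embedding.subtype_apply, Subtype.exists, exists_and_right, exists_eq_right,
    Finset.restrict₂]
  constructor
  · rintro ⟨hi, h⟩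
    have : i ∈ V := by
      by_contra hn
      exact absurd (hy ⟨i, hi⟩ hn) (not_lt.2 h)
    exact ⟨this, h⟩
  · rintro ⟨hi, h⟩
    exact ⟨hV hi, h⟩

/-- The items of `N` are all suppressed with probability at least `1 - δ / 2` if their weights are
at most `h |N|`. -/
theorem noisyWeights_suppressed {h : ℕ → ℝ} {δ σ : ℝ} (hδ : 0 < δ) (hδ' : δ ≤ 1)
    (hσ : 0 < σ) {Δ₀ : ℕ} {w : Item → ℝ} {N : Finset Item} (hN : N.card ≤ Δ₀)
    (hw : ∀ i ∈ N, w i ≤ h N.card) :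
    ENNReal.ofReal (1 - δ / 2) ≤
      noisyWeights w σ N (Set.univ.pi fun _ => Set.Iio (threshold h δ Δ₀ σ)) := by
  rw [noisyWeights, Measure.pi_pi]
  rcases N.eq_empty_or_nonempty with rfl | hne
  -- The maximum in the threshold starts at `t = 1`, so no novel items is a separate case: the empty
  -- product is 1.
  · simp; linarith
  have ht : 1 ≤ N.card := hne.card_pos
  set p : ℝ := (1 - δ / 2) ^ (1 / (N.card : ℝ)) with hp
  have ht0 : (0 : ℝ) < N.card := by exact_mod_cast ht
  have hp1 : p < 1 := Real.rpow_lt_one (by linarith) (by linarith) (by positivity)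
  have hpow : p ^ N.card = 1 - δ / 2 := by
    rw [hp, one_div, Real.rpow_inv_natCast_pow (by linarith) (by omega)]
  have hv : Real.toNNReal (σ ^ 2) ≠ 0 := by
    rw [Ne, Real.toNNReal_eq_zero, not_le]; positivity
  have hp0 : 0 ≤ p := Real.rpow_nonneg (by linarith) _
  calc ENNReal.ofReal (1 - δ / 2) = ∏ _i : N, ENNReal.ofReal p := by
        rw [Finset.prod_const, Finset.card_univ, Fintype.card_coe, ← ENNReal.ofReal_pow hp0, hpow]
    _ ≤ _ := by
        refine Finset.prod_le_prod' fun i _ => ?_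
        have := nullSingletonClass_gaussianReal (μ := w i) hv
        rw [Iio_ae_eq_Iic.measure_eq, gaussianReal_Iic_eq _ hσ]
        refine ENNReal.ofReal_le_ofReal ((le_gaussianCDF_gaussianQuantile hp1).trans
          (monotone_cdf _ ?_))
        rw [le_div_iff₀ hσ]
        have h1 := le_threshold h δ σ ht hN
        have h2 := hw i i.2
        rw [← hp] at h1
        linarith

/-- The event `F` that all of `N` is suppressed is independent of the coordinates in `V`, and on it
the two releases coincide. Each direction spends `δ / 2` on the Gaussian mechanism over `V` and `δ /
2` on the complement of `F`. -/
theorem thresholdLaw_le_both {h : ℕ → ℝ} {ε δ σ : ℝ} (hδ : 0 < δ) (hδ' : δ ≤ 1)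
    (hσ : IsGaussianScale ε (δ / 2) 1 σ) {Δ₀ : ℕ} {w w' : Item → ℝ} {V V' : Finset Item}
    (hV : V ⊆ V') (hw : ∑ i ∈ V, (w' i - w i) ^ 2 ≤ 1)
    {N : Finset Item} (hNV : N ⊆ V') (hdisj : Disjoint V N) (hcov : ∀ i ∈ V', i ∉ V → i ∈ N)
    (hN : N.card ≤ Δ₀) (hw' : ∀ i ∈ N, w' i ≤ h N.card) (O : Set (Output Item)) :
    thresholdLaw w σ (threshold h δ Δ₀ σ) V O ≤
        ENNReal.ofReal (Real.exp ε) * thresholdLaw w' σ (threshold h δ Δ₀ σ) V' O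
          + ENNReal.ofReal δ ∧
      thresholdLaw w' σ (threshold h δ Δ₀ σ) V' O ≤
        ENNReal.ofReal (Real.exp ε) * thresholdLaw w σ (threshold h δ Δ₀ σ) V O
          + ENNReal.ofReal δ := by
  set ρ := threshold h δ Δ₀ σ
  have mO : MeasurableSet O := trivial
  have hm := measurable_released (0 : Item → ℝ) ρ
  rw [thresholdLaw_eq_map, thresholdLaw_eq_map, Measure.map_apply (hm V) mO,
    Measure.map_apply (hm V') mO]
  set B := released (0 : Item → ℝ) ρ V ⁻¹' O
  set B' := released (0 : Item → ℝ) ρ V' ⁻¹' O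
  have mB : MeasurableSet B := hm V mO
  have mB' : MeasurableSet B' := hm V' mO
  set μ := noisyWeights w' σ V'
  set RV := Finset.restrict₂ (π := fun _ => ℝ) hV
  set RN := Finset.restrict₂ (π := fun _ => ℝ) hNV
  have mRV : Measurable RV := Finset.measurable_restrict₂ hV
  have mRN : Measurable RN := Finset.measurable_restrict₂ hNV
  set F : Set (N → ℝ) := Set.univ.pi fun _ => Set.Iio ρ
  have mF : MeasurableSet F := MeasurableSet.univ_pi fun _ => measurableSet_Iio
  have hE : ENNReal.ofReal (1 - δ / 2) ≤ μ (RN ⁻¹' F) := by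
    rw [← Measure.map_apply mRN mF, noisyWeights_map_restrict]
    exact noisyWeights_suppressed hδ hδ' hσ.1 hN hw'
  have hE1 : μ (RN ⁻¹' F) ≤ 1 := prob_le_one
  have hEc : μ (RN ⁻¹' F)ᶜ ≤ ENNReal.ofReal (δ / 2) := by
    rw [prob_compl_eq_one_sub (mRN mF), tsub_le_iff_right]
    calc (1 : ℝ≥0∞) = ENNReal.ofReal (δ / 2) + ENNReal.ofReal (1 - δ / 2) := by
          rw [← ENNReal.ofReal_add (by linarith) (by linarith)]; simp
      _ ≤ _ := by gcongr
  have hBF : B' ∩ RN ⁻¹' F = RV ⁻¹' B ∩ RN ⁻¹' F := by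
    ext y
    refine and_congr_left fun hy => ?_
    have : released 0 ρ V' y = released 0 ρ V (RV y) := released_eq_of_lt hV fun i hi =>
      hy ⟨i, hcov i i.2 hi⟩ trivial
    simp only [B, B', Set.mem_preimage, this]
  have hind : μ (B' ∩ RN ⁻¹' F) = noisyWeights w' σ V B * μ (RN ⁻¹' F) := by
    rw [hBF, (indepFun_restrict_noisyWeights w' σ hV hNV hdisj).measure_inter_preimage_eq_mul
      _ _ mB mF, ← noisyWeights_map_restrict w' σ hV, Measure.map_apply mRV mB]
  have hδ2 : ENNReal.ofReal δ = ENNReal.ofReal (δ / 2) + ENNReal.ofReal (δ / 2) := by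
    rw [← ENNReal.ofReal_add (by linarith) (by linarith), add_halves]
  have hsum : ∑ i : V, (w' i - w i) ^ 2 ≤ 1 := by
    rwa [Finset.sum_coe_sort V fun i => (w' i - w i) ^ 2]
  have g1 : noisyWeights w σ V B ≤ ENNReal.ofReal (Real.exp ε) * noisyWeights w' σ V B
      + ENNReal.ofReal (δ / 2) :=
    pi_gaussianReal_le (by linarith) hσ _ _ (by simpa only [← sub_sq_comm] using hsum) mB
  have g2 : noisyWeights w' σ V B ≤ ENNReal.ofReal (Real.exp ε) * noisyWeights w σ V B
      + ENNReal.ofReal (δ / 2) := pi_gaussianReal_le (by linarith) hσ _ _ hsum mB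
  constructor
  -- Splitting off the factor `μ F + μ Fᶜ = 1` leaves `noisyWeights w' σ V B * μ F`, which
  -- independence identifies with the probability of `B' ∩ F`.
  · calc noisyWeights w σ V B
        = noisyWeights w σ V B * (μ (RN ⁻¹' F) + μ (RN ⁻¹' F)ᶜ) := by
          rw [prob_add_prob_compl (mRN mF), mul_one]
      _ ≤ (ENNReal.ofReal (Real.exp ε) * noisyWeights w' σ V B + ENNReal.ofReal (δ / 2))
            * μ (RN ⁻¹' F) + 1 * ENNReal.ofReal (δ / 2) := by
          rw [mul_add]
          gcongr
          exact prob_le_one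
      _ = ENNReal.ofReal (Real.exp ε) * (noisyWeights w' σ V B * μ (RN ⁻¹' F))
            + ENNReal.ofReal (δ / 2) * μ (RN ⁻¹' F) + ENNReal.ofReal (δ / 2) := by ring
      _ ≤ ENNReal.ofReal (Real.exp ε) * μ B' + ENNReal.ofReal (δ / 2) * 1
            + ENNReal.ofReal (δ / 2) := by
          rw [← hind]
          gcongr
          exact Set.inter_subset_left
      _ = _ := by rw [hδ2]; ring
  · calc μ B' = μ (B' ∩ RN ⁻¹' F) + μ (B' \ RN ⁻¹' F) :=
          (measure_inter_add_sdiff _ (mRN mF)).symm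
      _ ≤ noisyWeights w' σ V B * 1 + μ (RN ⁻¹' F)ᶜ := by
          rw [hind]
          gcongr
          exact fun x hx => hx.2
      _ ≤ (ENNReal.ofReal (Real.exp ε) * noisyWeights w σ V B + ENNReal.ofReal (δ / 2)) * 1
            + ENNReal.ofReal (δ / 2) := by gcongr
      _ = _ := by rw [hδ2]; ring

end

/-! ### From sensitivity bounds to privacy -/

/-- `S'` is `S` together with the new user `v`. -/
structure AddsUserAt {User Item : Type*} (v : User) (S S' : Dataset User Item) : Prop where
  notMem : v ∉ S.users
  users_eq : S'.users = Finset.cons v S.users notMem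
  items_eq : ∀ u ∈ S.users, S'.items u = S.items u

section

variable {User Item : Type*} {v : User} {S S' : Dataset User Item}

theorem AddsUserAt.mem_users (hS : AddsUserAt v S S') : v ∈ S'.users := by
  rw [hS.users_eq]; exact Finset.mem_cons_self _ _

theorem AddsUserAt.mem_of_mem (hS : AddsUserAt v S S') {u : User} (hu : u ∈ S.users) :
    u ∈ S'.users := by
  rw [hS.users_eq]; exact Finset.mem_cons_of_mem hu

theorem AddsUserAt.mem_users_iff (hS : AddsUserAt v S S') {u : User} :
    u ∈ S'.users ↔ u = v ∨ u ∈ S.users := by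
  rw [hS.users_eq, Finset.mem_cons]

/-- Forget the subsample of the new user. -/
def AddsUserAt.forget (hS : AddsUserAt v S S') (f : ∀ u ∈ S'.users, Finset Item) :
    ∀ u ∈ S.users, Finset Item := fun u hu => f u (hS.mem_of_mem hu)

theorem mem_cappings {Δ₀ : ℕ} {f : ∀ u ∈ S.users, Finset Item} :
    f ∈ cappings Δ₀ S ↔ ∀ u (hu : u ∈ S.users), f u hu ∈ capChoices Δ₀ (S.items u) := by
  classical
  exact Finset.mem_pi

theorem capChoices_card_ne_zero (Δ₀ : ℕ) (A : Finset Item) : (capChoices Δ₀ A).card ≠ 0 := by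
  rw [capChoices, Finset.card_powersetCard]
  exact (Nat.choose_pos (min_le_left _ _)).ne'

theorem card_le_of_mem_capChoices {Δ₀ : ℕ} {A B : Finset Item} (h : B ∈ capChoices Δ₀ A) :
    B.card ≤ Δ₀ :=
  (Finset.mem_powersetCard.1 h).2.trans_le (min_le_right _ _)

theorem cappings_card_ne_zero (Δ₀ : ℕ) (S : Dataset User Item) : (cappings Δ₀ S).card ≠ 0 := by
  classical
  rw [cappings, Finset.card_pi, Finset.prod_ne_zero_iff]
  exact fun u _ => capChoices_card_ne_zero _ _

/-- A capping of `S'` is a capping of `S` plus an independent choice for `v`, which `G` ignores. -/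
theorem AddsUserAt.sum_cappings (hS : AddsUserAt v S S') (Δ₀ : ℕ)
    (G : (∀ u ∈ S.users, Finset Item) → ℝ≥0∞) :
    ∑ f ∈ cappings Δ₀ S', G (hS.forget f) =
      ((capChoices Δ₀ (S'.items v)).card : ℝ≥0∞) * ∑ f ∈ cappings Δ₀ S, G f := by
  classical
  trans ∑ p ∈ cappings Δ₀ S ×ˢ capChoices Δ₀ (S'.items v), G p.1
  · refine Finset.sum_nbij' (fun f => (hS.forget f, f v hS.mem_users))
      (fun p u hu => if h : u = v then p.2 else
        p.1 u ((hS.mem_users_iff.1 hu).resolve_left h)) ?_ ?_ ?_ ?_ ?_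
    · intro f hf
      rw [mem_cappings] at hf
      refine Finset.mem_product.2 ⟨mem_cappings.2 fun u hu => ?_, hf v hS.mem_users⟩
      rw [← hS.items_eq u hu]
      exact hf u _
    · intro p hp
      obtain ⟨h1, h2⟩ := Finset.mem_product.1 hp
      rw [mem_cappings] at h1
      refine mem_cappings.2 fun u hu => ?_
      by_cases h : u = v
      · subst h
        simpa using h2
      · have hu' := (hS.mem_users_iff.1 hu).resolve_left h
        simpa [h, hS.items_eq u hu'] using h1 u hu'
    · intro f _
      funext u hu
      by_cases h : u = v
      · subst h
        simp
      · simp [h, AddsUserAt.forget]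
    · intro p _
      refine Prod.ext ?_ (by simp)
      funext u hu
      have h : u ≠ v := fun h => hS.notMem (h ▸ hu)
      simp [h, AddsUserAt.forget]
    · intro f _
      rfl
  · rw [Finset.sum_product]
    simp only [Finset.sum_const, nsmul_eq_mul, Finset.mul_sum]

theorem AddsUserAt.card_cappings (hS : AddsUserAt v S S') (Δ₀ : ℕ) :
    ((cappings Δ₀ S').card : ℝ≥0∞) =
      ((capChoices Δ₀ (S'.items v)).card : ℝ≥0∞) * (cappings Δ₀ S).card := by
  simpa using hS.sum_cappings Δ₀ fun _ => 1

theorem weightAndThreshold_apply (ALG : Dataset User Item → Item → ℝ) (h : ℕ → ℝ) (δ : ℝ)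
    (Δ₀ : ℕ) (σ : ℝ) (S : Dataset User Item) (O : Set (Output Item)) :
    weightAndThreshold ALG h δ Δ₀ σ S O = ((cappings Δ₀ S).card : ℝ≥0∞)⁻¹ *
      ∑ f ∈ cappings Δ₀ S,
        thresholdLaw (ALG (S.capped f)) σ (threshold h δ Δ₀ σ) (S.capped f).union O := by
  simp [weightAndThreshold]

/-- The law on the smaller dataset as an average over the subsamples of the larger one. -/
theorem AddsUserAt.weightAndThreshold_apply (hS : AddsUserAt v S S')
    (ALG : Dataset User Item → Item → ℝ) (h : ℕ → ℝ) (δ : ℝ)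
    (Δ₀ : ℕ) (σ : ℝ) (O : Set (Output Item)) :
    weightAndThreshold ALG h δ Δ₀ σ S O = ((cappings Δ₀ S').card : ℝ≥0∞)⁻¹ *
      ∑ f ∈ cappings Δ₀ S', thresholdLaw (ALG (S.capped (hS.forget f))) σ (threshold h δ Δ₀ σ)
        (S.capped (hS.forget f)).union O := by
  rw [hS.sum_cappings Δ₀ fun f => thresholdLaw (ALG (S.capped f)) σ (threshold h δ Δ₀ σ)
        (S.capped f).union O, hS.card_cappings, PartitionSelection.weightAndThreshold_apply]
  have h0 : ((capChoices Δ₀ (S'.items v)).card : ℝ≥0∞) ≠ 0 := by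
    exact_mod_cast capChoices_card_ne_zero _ _
  have h1 : ((capChoices Δ₀ (S'.items v)).card : ℝ≥0∞) ≠ ∞ := ENNReal.natCast_ne_top _
  rw [ENNReal.mul_inv (Or.inl h0) (Or.inl h1), mul_mul_mul_comm, ENNReal.inv_mul_cancel h0 h1, one_mul]

theorem average_le {ι : Type*} {s : Finset ι} (hs : s.card ≠ 0) {a b : ι → ℝ≥0∞} {c d : ℝ≥0∞}
    (h : ∀ i ∈ s, a i ≤ c * b i + d) :
    (s.card : ℝ≥0∞)⁻¹ * ∑ i ∈ s, a i ≤ c * ((s.card : ℝ≥0∞)⁻¹ * ∑ i ∈ s, b i) + d := by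
  calc (s.card : ℝ≥0∞)⁻¹ * ∑ i ∈ s, a i
      ≤ (s.card : ℝ≥0∞)⁻¹ * ∑ i ∈ s, (c * b i + d) := by gcongr with i hi; exact h i hi
    _ = c * ((s.card : ℝ≥0∞)⁻¹ * ∑ i ∈ s, b i) + (s.card : ℝ≥0∞)⁻¹ * s.card * d := by
        rw [Finset.sum_add_distrib, ← Finset.mul_sum, Finset.sum_const, nsmul_eq_mul]
        ring
    _ = _ := by
        rw [ENNReal.inv_mul_cancel (by exact_mod_cast hs) (ENNReal.natCast_ne_top _), one_mul]

/-- The coupling: giving common users the same subsamples keeps the capped datasets neighbouring. -/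
theorem AddsUserAt.capped (hS : AddsUserAt v S S') (f : ∀ u ∈ S'.users, Finset Item) :
    AddsUserAt v (S.capped (hS.forget f)) (S'.capped f) where
  notMem := hS.notMem
  users_eq := hS.users_eq
  items_eq u hu := by
    have h1 : u ∈ S.users := hu
    have h2 : u ∈ S'.users := hS.mem_of_mem h1
    simp [Dataset.capped, h1, h2, AddsUserAt.forget]

theorem AddsUserAt.mem_union_iff (hS : AddsUserAt v S S') {i : Item} :
    i ∈ S'.union ↔ i ∈ S'.items v ∨ i ∈ S.union := by
  classical
  simp only [Dataset.union, Finset.mem_biUnion]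
  constructor
  · rintro ⟨u, hu, hi⟩
    rcases hS.mem_users_iff.1 hu with rfl | hu
    · exact Or.inl hi
    · exact Or.inr ⟨u, hu, hS.items_eq u hu ▸ hi⟩
  · rintro (hi | ⟨u, hu, hi⟩)
    · exact ⟨v, hS.mem_users, hi⟩
    · exact ⟨u, hS.mem_of_mem hu, (hS.items_eq u hu).symm ▸ hi⟩

open Classical in
/-- A weighting algorithm of `ℓ₂` sensitivity at most `1`, for which `t` novel items have weights
at most `h t`, gives a private release. -/
theorem isDP_weightAndThreshold (ALG : Dataset User Item → Item → ℝ) {h : ℕ → ℝ}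
    {ε δ σ : ℝ} (hδ : 0 < δ) (hδ' : δ ≤ 1) (hσ : IsGaussianScale ε (δ / 2) 1 σ) (Δ₀ : ℕ)
    (hsens : ∀ (v : User) (D D' : Dataset User Item), AddsUserAt v D D' →
      ∑ i ∈ D.union, (ALG D' i - ALG D i) ^ 2 ≤ 1)
    (hnovel : ∀ (v : User) (D D' : Dataset User Item), AddsUserAt v D D' →
      ∀ i ∈ D'.items v \ D.union, ALG D' i ≤ h (D'.items v \ D.union).card) :
    IsDP ε δ (weightAndThreshold ALG h δ Δ₀ σ) := by
  -- Everything is proved for a fixed vector `f` of subsamples. Capping bounds the set of `v`, hence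
  -- the number of novel items, by `Δ₀`.
  have key : ∀ (v : User) (S S' : Dataset User Item) (hS : AddsUserAt v S S')
      (O : Set (Output Item)), ∀ f ∈ cappings Δ₀ S', _ := fun v S S' hS O f hf =>
    have hD := hS.capped f
    have hcard : ((S'.capped f).items v).card ≤ Δ₀ := by
      simpa [Dataset.capped, hS.mem_users] using
        card_le_of_mem_capChoices (mem_cappings.1 hf v hS.mem_users)
    thresholdLaw_le_both (h := h) hδ hδ' hσ (fun i hi => hD.mem_union_iff.2 (Or.inr hi))
      (hsens v _ _ hD) (N := (S'.capped f).items v \ (S.capped (hS.forget f)).union)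
      (fun i hi => hD.mem_union_iff.2 (Or.inl (Finset.mem_sdiff.1 hi).1))
      Finset.disjoint_sdiff
      (fun i hi hi' => Finset.mem_sdiff.2 ⟨(hD.mem_union_iff.1 hi).resolve_right hi', hi'⟩)
      ((Finset.card_le_card Finset.sdiff_subset).trans hcard) (hnovel v _ _ hD) O
  rintro S S' (⟨v, hv, hu, hi⟩ | ⟨v, hv, hu, hi⟩) O
  · have hS : AddsUserAt v S S' := ⟨hv, hu, hi⟩
    rw [hS.weightAndThreshold_apply, weightAndThreshold_apply]
    exact average_le (cappings_card_ne_zero _ _) fun f hf => (key v S S' hS O f hf).1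
  · have hS : AddsUserAt v S' S := ⟨hv, hu, hi⟩
    rw [hS.weightAndThreshold_apply, weightAndThreshold_apply]
    exact average_le (cappings_card_ne_zero _ _) fun f hf => (key v S' S hS O f hf).2

end

/-! ### Two numerical inequalities -/

theorem one_half_lt_rerouteFactor {d : ℝ} (hd : 1 < d) : 1 / 2 < rerouteFactor d := by
  have h : 1 < √d := Real.lt_sqrt_of_sq_lt (by simpa using hd)
  have : 1 / (2 * √d) < 1 / 2 := by
    rw [div_lt_div_iff₀ (by positivity) (by norm_num)]; linarith
  unfold rerouteFactor
  linarith

theorem rerouteFactor_le_one (d : ℝ) : rerouteFactor d ≤ 1 := by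
  have : 0 ≤ 1 / (2 * √d) := by positivity
  unfold rerouteFactor
  linarith

theorem two_mul_rerouteFactor_mul {d : ℝ} (hd : 1 < d) : 2 * rerouteFactor d * √d = 2 * √d - 1 := by
  have h : 0 < √d := Real.sqrt_pos.2 (by linarith)
  unfold rerouteFactor
  field_simp

/-- The weight rerouted to a user of degree `k ≤ d` is paid by its truncated weight. -/
theorem two_mul_rerouteFactor_mul_sqrt_div_le {d k : ℝ} (hk : 1 ≤ k) (hkd : k ≤ d) (hd : 1 < d) :
    2 * rerouteFactor d * √k / d ≤ 2 / √k - 1 / k := by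
  have hα := two_mul_rerouteFactor_mul hd
  set a := √k with ha
  set b := √d with hb
  have hk2 : k = a ^ 2 := (Real.sq_sqrt (by linarith)).symm
  have hd2 : d = b ^ 2 := (Real.sq_sqrt (by linarith)).symm
  have ha1 : 1 ≤ a := Real.one_le_sqrt.2 hk
  have hab : a ≤ b := Real.sqrt_le_sqrt hkd
  have hb1 : 1 ≤ b := ha1.trans hab
  have e1 : 2 * rerouteFactor d * a / d = (2 * b - 1) * a / b ^ 3 := by
    rw [← hα, hd2]; field_simp
  have e2 : 2 / a - 1 / k = (2 * a - 1) / a ^ 2 := by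
    rw [hk2]; field_simp
  -- Cross-multiplied, the difference of the sides is `(b - a) * (2ab(a + b) - (a² + ab + b²))`. It
  -- vanishes at `k = d`, so `α` is the largest factor the inequality allows.
  rw [e1, e2, div_le_div_iff₀ (by positivity) (by positivity)]
  have h1 : b ^ 2 + a * b + a ^ 2 ≤ 2 * a * b * (a + b) := by
    nlinarith [mul_nonneg (sub_nonneg.2 ha1) (sq_nonneg b), mul_nonneg (sub_nonneg.2 hb1)
      (sq_nonneg a), mul_nonneg (sub_nonneg.2 ha1) (mul_nonneg (by linarith : 0 ≤ a)
      (by linarith : 0 ≤ b)), mul_nonneg (mul_nonneg (by linarith : 0 ≤ a)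
      (by linarith : 0 ≤ b)) (sub_nonneg.2 hab)]
  nlinarith [mul_nonneg (sub_nonneg.2 hab) (sub_nonneg.2 h1)]

/-- Writing `k - t = (a - c)(a + c)` and dividing by `a - c` leaves `α (a + c) c ≤ a b²`. This
follows from `c ≤ a` and `2 α a ≤ 2 α b = 2b - 1 ≤ b²`. -/
theorem one_div_sqrt_add_le {d k t : ℝ} (ht : 1 ≤ t) (htk : t ≤ k) (hkd : k ≤ d) (hd : 1 < d) :
    1 / √k + rerouteFactor d * ((k - t) / k) / d ≤ 1 / √t := by
  have hα := two_mul_rerouteFactor_mul hd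
  have hα0 : 0 < rerouteFactor d := by linarith [one_half_lt_rerouteFactor hd]
  set α := rerouteFactor d
  set a := √k with ha
  set b := √d with hb
  set c := √t with hc
  have hk2 : k = a ^ 2 := (Real.sq_sqrt (by linarith)).symm
  have hd2 : d = b ^ 2 := (Real.sq_sqrt (by linarith)).symm
  have ht2 : t = c ^ 2 := (Real.sq_sqrt (by linarith)).symm
  have hc1 : 1 ≤ c := Real.one_le_sqrt.2 ht
  have hca : c ≤ a := Real.sqrt_le_sqrt htk
  have hab : a ≤ b := Real.sqrt_le_sqrt hkd
  have h1 : α * (a + c) * c ≤ a * b ^ 2 := by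
    have h2 : 2 * α * a ≤ b ^ 2 := by
      nlinarith [mul_nonneg hα0.le (sub_nonneg.2 hab), sq_nonneg (b - 1)]
    have h3 : (a + c) * c ≤ 2 * a * a := by nlinarith
    nlinarith [mul_le_mul_of_nonneg_left h3 hα0.le,
      mul_le_mul_of_nonneg_left h2 (by linarith : 0 ≤ a)]
  have e : 1 / c - (1 / a + α * ((k - t) / k) / d) =
      (a - c) * (a * b ^ 2 - α * (a + c) * c) / (a ^ 2 * b ^ 2 * c) := by
    have : 0 < a := by linarith
    have : 0 < b := by linarith
    rw [hk2, hd2, ht2]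
    field_simp
    ring
  have : 0 ≤ (a - c) * (a * b ^ 2 - α * (a + c) * c) / (a ^ 2 * b ^ 2 * c) := by
    have : 0 ≤ a - c := by linarith
    have : 0 ≤ a * b ^ 2 - α * (a + c) * c := by linarith
    positivity
  linarith

/-- The `ℓ₂` bound behind the sensitivity of MAD: the new user adds `1 / √k - s i` to its own
`k` items, and at most `m` of rerouted weight `y i` to every item. -/
theorem sum_sq_add_le_one {Item : Type*} [DecidableEq Item] {d : ℝ} (hd : 1 < d)
    {A W : Finset Item} (hAW : A ⊆ W) (hA : A.Nonempty) (hAd : (A.card : ℝ) ≤ d)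
    {s y : Item → ℝ} (hs0 : ∀ i ∈ A, 0 ≤ s i) (hs1 : ∀ i ∈ A, s i ≤ 1 / (A.card : ℝ))
    (hy0 : ∀ i ∈ W, 0 ≤ y i) (hym : ∀ i ∈ W, y i ≤ rerouteFactor d * (∑ j ∈ A, s j) / d)
    (hy : ∑ i ∈ W, y i ≤ rerouteFactor d * ∑ j ∈ A, s j) :
    ∑ i ∈ W, ((if i ∈ A then 1 / √(A.card : ℝ) - s i else 0) + y i) ^ 2 ≤ 1 := by
  have hk : (1 : ℝ) ≤ A.card := by exact_mod_cast hA.card_pos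
  have hnum := two_mul_rerouteFactor_mul_sqrt_div_le hk hAd hd
  have hα1 := rerouteFactor_le_one d
  have hα0 : 0 < rerouteFactor d := by linarith [one_half_lt_rerouteFactor hd]
  set α := rerouteFactor d
  set k : ℝ := (A.card : ℝ) with hkdef
  set T : ℝ := ∑ j ∈ A, s j with hT
  set m : ℝ := α * T / d with hm
  have hT0 : 0 ≤ T := Finset.sum_nonneg hs0
  have hm0 : 0 ≤ m := by positivity
  have hdm : d * m = α * T := by rw [hm]; field_simp
  have hsk : √k * √k = k := Real.mul_self_sqrt (by linarith)
  have hk1 : 1 ≤ √k := Real.one_le_sqrt.2 hk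
  have hq0 : ∀ i ∈ A, 0 ≤ 1 / √k - s i := fun i hi => by
    have h1 := hs1 i hi
    have h2 : 1 / k ≤ 1 / √k := by
      apply one_div_le_one_div_of_le (by positivity)
      nlinarith
    linarith
  have hexp : ∑ i ∈ W, ((if i ∈ A then 1 / √k - s i else 0) + y i) ^ 2 =
      ∑ i ∈ A, (1 / √k - s i) ^ 2 + 2 * ∑ i ∈ A, (1 / √k - s i) * y i + ∑ i ∈ W, y i ^ 2 := by
    have hf : ∀ g : Item → ℝ, ∑ i ∈ A, g i = ∑ i ∈ W, if i ∈ A then g i else 0 := fun g => by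
      rw [Finset.sum_ite_mem, Finset.inter_eq_right.2 hAW]
    rw [hf, hf, Finset.mul_sum, ← Finset.sum_add_distrib, ← Finset.sum_add_distrib]
    refine Finset.sum_congr rfl fun i _ => ?_
    split_ifs <;> ring
  have h1 : ∑ i ∈ A, (1 / √k - s i) ^ 2 ≤ 1 - 2 / √k * T + T / k := by
    have : ∀ i ∈ A, (1 / √k - s i) ^ 2 ≤ 1 / k - 2 / √k * s i + s i * (1 / k) := fun i hi => by
      have e : (1 / √k - s i) ^ 2 = 1 / k - 2 / √k * s i + s i * s i := by
        rw [sub_sq, div_pow, sq √k, hsk]; ring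
      rw [e]
      have := mul_le_mul_of_nonneg_left (hs1 i hi) (hs0 i hi)
      linarith
    refine (Finset.sum_le_sum this).trans_eq ?_
    rw [Finset.sum_add_distrib, Finset.sum_sub_distrib, ← Finset.mul_sum, ← Finset.sum_mul,
      Finset.sum_const, nsmul_eq_mul, ← hT, ← hkdef]
    field_simp
  have h2 : ∑ i ∈ A, (1 / √k - s i) * y i ≤ m * (√k - T) := by
    calc ∑ i ∈ A, (1 / √k - s i) * y i ≤ ∑ i ∈ A, (1 / √k - s i) * m :=
          Finset.sum_le_sum fun i hi => mul_le_mul_of_nonneg_left (hym i (hAW hi)) (hq0 i hi)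
      _ = m * (√k - T) := by
          rw [← Finset.sum_mul, Finset.sum_sub_distrib, Finset.sum_const, nsmul_eq_mul, ← hT,
            ← hkdef, mul_one_div, Real.div_sqrt, mul_comm]
  have h3 : ∑ i ∈ W, y i ^ 2 ≤ m * T := by
    calc ∑ i ∈ W, y i ^ 2 ≤ ∑ i ∈ W, m * y i := Finset.sum_le_sum fun i hi => by
          rw [sq]; exact mul_le_mul_of_nonneg_right (hym i hi) (hy0 i hi)
      _ = m * ∑ i ∈ W, y i := by rw [Finset.mul_sum]
      _ ≤ m * (α * T) := mul_le_mul_of_nonneg_left hy hm0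
      _ ≤ m * T := mul_le_mul_of_nonneg_left (by nlinarith) hm0
  have h4 : 2 * m * √k ≤ 2 / √k * T - T / k := by
    have := mul_le_mul_of_nonneg_right hnum hT0
    calc 2 * m * √k = 2 * α * √k / d * T := by rw [hm]; ring
      _ ≤ _ := this
      _ = _ := by ring
  have h5 : 0 ≤ m * T := mul_nonneg hm0 hT0
  -- Altogether the sum is at most `1 - (2/√k - 1/k) T + 2m(√k - T) + mT`; `h4` absorbs `2m√k`,
  -- leaving at most `1 - mT`.
  rw [hexp]
  linarith

/-! ### Sensitivity of the weighting algorithms -/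

section

variable {User Item : Type*} {v : User} {S S' : Dataset User Item}

open Classical in
theorem sum_holders_cons {T : Finset User} (hv : v ∉ T) (hT : ∀ u ∈ T, S'.items u = S.items u)
    (g : Finset Item → ℝ) (i : Item) :
    ∑ u ∈ Finset.cons v T hv with i ∈ S'.items u, g (S'.items u) =
      (if i ∈ S'.items v then g (S'.items v) else 0) +
        ∑ u ∈ T with i ∈ S.items u, g (S.items u) := by
  rw [Finset.sum_filter, Finset.sum_cons, Finset.sum_filter]
  congr 1
  exact Finset.sum_congr rfl fun u hu => by rw [hT u hu]

open Classical in
theorem AddsUserAt.basic_eq (hS : AddsUserAt v S S') (i : Item) :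
    basic S' i = (if i ∈ S'.items v then 1 / √((S'.items v).card : ℝ) else 0) + basic S i := by
  rw [basic, hS.users_eq]
  exact sum_holders_cons hS.notMem hS.items_eq (fun A => 1 / √(A.card : ℝ)) i

theorem mem_adaptiveUsers {dmax : ℝ} {u : User} : u ∈ adaptiveUsers dmax S ↔
    u ∈ S.users ∧ 1 ≤ (S.items u).card ∧ ((S.items u).card : ℝ) ≤ dmax := by
  rw [adaptiveUsers, Finset.mem_filter]

theorem adaptiveUsers_subset (dmax : ℝ) (S : Dataset User Item) :
    adaptiveUsers dmax S ⊆ S.users := Finset.filter_subset _ _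

theorem AddsUserAt.mem_adaptiveUsers_iff (hS : AddsUserAt v S S') {dmax : ℝ} {u : User} :
    u ∈ adaptiveUsers dmax S' ↔
      (u = v ∧ 1 ≤ (S'.items v).card ∧ ((S'.items v).card : ℝ) ≤ dmax) ∨
        u ∈ adaptiveUsers dmax S := by
  rw [mem_adaptiveUsers, mem_adaptiveUsers, hS.mem_users_iff]
  constructor
  · rintro ⟨rfl | hu, h⟩
    · exact Or.inl ⟨rfl, h⟩
    · exact Or.inr ⟨hu, hS.items_eq u hu ▸ h⟩
  · rintro (⟨rfl, h⟩ | ⟨hu, h⟩)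
    · exact ⟨Or.inl rfl, h⟩
    · exact ⟨Or.inr hu, (hS.items_eq u hu).symm ▸ h⟩

theorem AddsUserAt.notMem_adaptiveUsers (hS : AddsUserAt v S S') (dmax : ℝ) :
    v ∉ adaptiveUsers dmax S := fun h => hS.notMem (adaptiveUsers_subset _ _ h)

theorem AddsUserAt.adaptiveUsers_eq_cons (hS : AddsUserAt v S S') {dmax : ℝ}
    (hv : 1 ≤ (S'.items v).card ∧ ((S'.items v).card : ℝ) ≤ dmax) :
    adaptiveUsers dmax S' =
      Finset.cons v (adaptiveUsers dmax S) (hS.notMem_adaptiveUsers dmax) := by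
  ext u
  rw [hS.mem_adaptiveUsers_iff, Finset.mem_cons]
  simp [hv]

theorem AddsUserAt.adaptiveUsers_eq (hS : AddsUserAt v S S') {dmax : ℝ}
    (hv : ¬(1 ≤ (S'.items v).card ∧ ((S'.items v).card : ℝ) ≤ dmax)) :
    adaptiveUsers dmax S' = adaptiveUsers dmax S := by
  ext u
  rw [hS.mem_adaptiveUsers_iff]
  simp only [hv, and_false, false_or]

theorem AddsUserAt.items_eq_of_adaptive (hS : AddsUserAt v S S') {dmax : ℝ} :
    ∀ u ∈ adaptiveUsers dmax S, S'.items u = S.items u :=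
  fun u hu => hS.items_eq u (adaptiveUsers_subset _ _ hu)

/-- MAD replaces the initial part of the basic weight by the truncated and rerouted weight. -/
theorem unbiasedMAD_eq (τ dmax : ℝ) (S : Dataset User Item) (i : Item) :
    unbiasedMAD τ dmax S i =
      truncWeight τ dmax S i + rerouteWeight τ dmax S i - initWeight dmax S i + basic S i := by
  classical
  have h : basic S i = ∑ u ∈ adaptiveUsers dmax S with i ∈ S.items u, 1 / √((S.items u).card : ℝ)
      + ∑ u ∈ S.users \ adaptiveUsers dmax S with i ∈ S.items u, 1 / √((S.items u).card : ℝ) := by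
    unfold basic
    rw [← Finset.sum_union (Finset.disjoint_filter_filter Finset.disjoint_sdiff),
      ← Finset.filter_union, Finset.union_sdiff_of_subset (adaptiveUsers_subset _ _)]
  rw [h, unbiasedMAD, Finset.sum_sub_distrib, initWeight]
  ring

theorem initWeight_nonneg (dmax : ℝ) (S : Dataset User Item) (i : Item) :
    0 ≤ initWeight dmax S i := Finset.sum_nonneg fun _ _ => by positivity

theorem excessRatio_nonneg (τ dmax : ℝ) (S : Dataset User Item) (i : Item) :
    0 ≤ excessRatio τ dmax S i := le_max_left _ _

theorem excessRatio_le_one {τ : ℝ} (hτ : 0 ≤ τ) (dmax : ℝ) (S : Dataset User Item) (i : Item) :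
    excessRatio τ dmax S i ≤ 1 :=
  max_le zero_le_one (div_le_one_of_le₀ (by linarith) (initWeight_nonneg _ _ _))

/-- The excess ratio times the initial weight is the amount cut off, including at weight zero, where
`τ ≥ 0` is needed. Conservation of excess rests on this. -/
theorem initWeight_mul_excessRatio {τ : ℝ} (hτ : 0 ≤ τ) (dmax : ℝ) (S : Dataset User Item)
    (i : Item) : initWeight dmax S i * excessRatio τ dmax S i =
      initWeight dmax S i - truncWeight τ dmax S i := by
  rw [excessRatio, truncWeight]
  rcases (initWeight_nonneg dmax S i).eq_or_lt with h | h
  · rw [← h, min_eq_left hτ]; simp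
  · rw [mul_max_of_nonneg _ _ h.le, mul_zero, mul_div_cancel₀ _ h.ne']
    rcases le_total (initWeight dmax S i) τ with h1 | h1
    · rw [min_eq_left h1, max_eq_left (by linarith), sub_self]
    · rw [min_eq_right h1, max_eq_right (by linarith)]

theorem excessRatio_mono {τ : ℝ} (hτ : 0 ≤ τ) {dmax : ℝ} {S S' : Dataset User Item} {i : Item}
    (h : initWeight dmax S i ≤ initWeight dmax S' i) :
    excessRatio τ dmax S i ≤ excessRatio τ dmax S' i := by
  rw [excessRatio, excessRatio]
  rcases (initWeight_nonneg dmax S i).eq_or_lt with h0 | h0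
  -- At weight zero the ratio is `0`, by division by zero.
  · rw [← h0]; simp
  · refine max_le_max le_rfl ?_
    have : 0 < initWeight dmax S' i := h0.trans_le h
    rw [sub_div, sub_div, div_self h0.ne', div_self this.ne']
    gcongr

theorem excessRatio_eq_zero {τ dmax : ℝ} {S : Dataset User Item} {i : Item}
    (h : initWeight dmax S i ≤ τ) : excessRatio τ dmax S i = 0 :=
  max_eq_left (div_nonpos_of_nonpos_of_nonneg (by linarith) (initWeight_nonneg _ _ _))

open Classical in
theorem sum_holders_eq_zero {T : Finset User} (hT : T ⊆ S.users) (g : User → ℝ) {i : Item}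
    (hi : i ∉ S.union) :
    ∑ u ∈ T with i ∈ S.items u, g u = 0 := by
  refine Finset.sum_eq_zero fun u hu => absurd ?_ hi
  rw [Finset.mem_filter] at hu
  exact Finset.mem_biUnion.2 ⟨u, hT hu.1, hu.2⟩

theorem basic_eq_zero {i : Item} (hi : i ∉ S.union) : basic S i = 0 :=
  sum_holders_eq_zero subset_rfl _ hi

theorem initWeight_eq_zero (dmax : ℝ) {i : Item} (hi : i ∉ S.union) : initWeight dmax S i = 0 :=
  sum_holders_eq_zero (adaptiveUsers_subset _ _) _ hi

theorem rerouteWeight_eq_zero (τ dmax : ℝ) {i : Item} (hi : i ∉ S.union) :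
    rerouteWeight τ dmax S i = 0 :=
  sum_holders_eq_zero (adaptiveUsers_subset _ _) _ hi

theorem sum_ite_uniform_sq_le_one [DecidableEq Item] (V A : Finset Item) :
    ∑ i ∈ V, (if i ∈ A then 1 / √(A.card : ℝ) else 0) ^ 2 ≤ 1 := by
  have h1 : ∑ i ∈ V, (if i ∈ A then 1 / √(A.card : ℝ) else 0) ^ 2 =
      ∑ i ∈ V ∩ A, 1 / (A.card : ℝ) := by
    rw [← Finset.sum_ite_mem]
    refine Finset.sum_congr rfl fun i _ => ?_
    split_ifs
    · rw [div_pow, one_pow, Real.sq_sqrt (by positivity)]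
    · simp
  rw [h1, Finset.sum_const, nsmul_eq_mul, mul_one_div]
  exact div_le_one_of_le₀ (by exact_mod_cast Finset.card_le_card Finset.inter_subset_right)
    (by positivity)

open Classical in
theorem one_div_sqrt_card_le {i : Item}
    (hi : i ∈ S'.items v \ S.union) :
    1 / √((S'.items v).card : ℝ) ≤ 1 / √((S'.items v \ S.union).card : ℝ) := by
  have h1 : 0 < (S'.items v \ S.union).card := Finset.card_pos.2 ⟨i, hi⟩
  apply one_div_le_one_div_of_le (by positivity)
  exact Real.sqrt_le_sqrt (by exact_mod_cast Finset.card_le_card Finset.sdiff_subset)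

open Classical in
theorem AddsUserAt.basic_novel (hS : AddsUserAt v S S') {i : Item}
    (hi : i ∈ S'.items v \ S.union) : basic S' i = 1 / √((S'.items v).card : ℝ) := by
  rw [hS.basic_eq, if_pos (Finset.mem_sdiff.1 hi).1, basic_eq_zero (Finset.mem_sdiff.1 hi).2,
    add_zero]

/-! #### A new user that is not adaptive -/

theorem AddsUserAt.initWeight_eq_of_not (hS : AddsUserAt v S S') {dmax : ℝ}
    (hv : ¬(1 ≤ (S'.items v).card ∧ ((S'.items v).card : ℝ) ≤ dmax)) :
    initWeight dmax S' = initWeight dmax S := by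
  classical
  funext i
  rw [initWeight, initWeight, hS.adaptiveUsers_eq hv, Finset.sum_filter, Finset.sum_filter]
  exact Finset.sum_congr rfl fun u hu => by rw [hS.items_eq_of_adaptive u hu]

/-- Initial weights, and with them truncation and excesses, ignore such a user, so only the basic
part moves. -/
theorem AddsUserAt.unbiasedMAD_sub_of_not (hS : AddsUserAt v S S') {dmax : ℝ} (τ : ℝ)
    (hv : ¬(1 ≤ (S'.items v).card ∧ ((S'.items v).card : ℝ) ≤ dmax)) (i : Item) :
    unbiasedMAD τ dmax S' i - unbiasedMAD τ dmax S i = basic S' i - basic S i := by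
  classical
  have hw := hS.initWeight_eq_of_not hv
  have hr : rerouteWeight τ dmax S' i = rerouteWeight τ dmax S i := by
    rw [rerouteWeight, rerouteWeight, hS.adaptiveUsers_eq hv, Finset.sum_filter,
      Finset.sum_filter]
    refine Finset.sum_congr rfl fun u hu => ?_
    simp only [userExcess, excessRatio, hw, hS.items_eq_of_adaptive u hu]
  rw [unbiasedMAD_eq, unbiasedMAD_eq, hr, truncWeight, truncWeight, hw]
  ring

/-! #### A new adaptive user -/

open Classical in
theorem AddsUserAt.initWeight_eq (hS : AddsUserAt v S S') {dmax : ℝ}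
    (hv : 1 ≤ (S'.items v).card ∧ ((S'.items v).card : ℝ) ≤ dmax) (i : Item) :
    initWeight dmax S' i =
      (if i ∈ S'.items v then 1 / ((S'.items v).card : ℝ) else 0) + initWeight dmax S i := by
  rw [initWeight, hS.adaptiveUsers_eq_cons hv]
  exact sum_holders_cons _ hS.items_eq_of_adaptive (fun A => 1 / (A.card : ℝ)) i

open Classical in
/-- The growth of the excess of user `u`, the new user starting from `0`. -/
noncomputable def excessGrowth (τ dmax : ℝ) (S S' : Dataset User Item) (u : User) : ℝ :=
  userExcess τ dmax S' u - if u ∈ S.users then userExcess τ dmax S u else 0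

theorem userExcess_nonneg (τ dmax : ℝ) (S : Dataset User Item) (u : User) :
    0 ≤ userExcess τ dmax S u :=
  mul_nonneg (by positivity) (Finset.sum_nonneg fun _ _ => excessRatio_nonneg _ _ _ _)

variable {τ dmax : ℝ}

theorem AddsUserAt.initWeight_le (hS : AddsUserAt v S S')
    (hv : 1 ≤ (S'.items v).card ∧ ((S'.items v).card : ℝ) ≤ dmax) (i : Item) :
    initWeight dmax S i ≤ initWeight dmax S' i := by
  classical
  rw [hS.initWeight_eq hv]
  have : (0 : ℝ) ≤ if i ∈ S'.items v then 1 / ((S'.items v).card : ℝ) else 0 := by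
    split_ifs <;> positivity
  linarith

theorem AddsUserAt.excessRatio_eq (hS : AddsUserAt v S S')
    (hv : 1 ≤ (S'.items v).card ∧ ((S'.items v).card : ℝ) ≤ dmax) {i : Item}
    (hi : i ∉ S'.items v) : excessRatio τ dmax S' i = excessRatio τ dmax S i := by
  rw [excessRatio, hS.initWeight_eq hv, if_neg hi, zero_add, excessRatio]

theorem AddsUserAt.excessGrowth_old (hS : AddsUserAt v S S') {u : User}
    (hu : u ∈ adaptiveUsers dmax S) :
    excessGrowth τ dmax S S' u = 1 / ((S.items u).card : ℝ) *
      ∑ j ∈ S.items u, (excessRatio τ dmax S' j - excessRatio τ dmax S j) := by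
  rw [excessGrowth, if_pos (adaptiveUsers_subset _ _ hu), userExcess, userExcess,
    hS.items_eq_of_adaptive u hu, ← mul_sub, Finset.sum_sub_distrib]

theorem AddsUserAt.excessGrowth_new (hS : AddsUserAt v S S') :
    excessGrowth τ dmax S S' v = userExcess τ dmax S' v := by
  rw [excessGrowth, if_neg hS.notMem, sub_zero]

theorem AddsUserAt.excessGrowth_nonneg (hS : AddsUserAt v S S') (hτ : 0 ≤ τ)
    (hv : 1 ≤ (S'.items v).card ∧ ((S'.items v).card : ℝ) ≤ dmax) {u : User}
    (hu : u ∈ adaptiveUsers dmax S') : 0 ≤ excessGrowth τ dmax S S' u := by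
  rcases hS.mem_adaptiveUsers_iff.1 hu with ⟨rfl, _⟩ | hu
  · rw [hS.excessGrowth_new]
    exact userExcess_nonneg _ _ _ _
  · rw [hS.excessGrowth_old hu]
    exact mul_nonneg (by positivity) (Finset.sum_nonneg fun j _ =>
      sub_nonneg.2 (excessRatio_mono hτ (hS.initWeight_le hv j)))

-- Starting the new user from excess `0` merges its contribution and the changes of the old users
-- into one sum.
open Classical in
theorem AddsUserAt.rerouteWeight_sub (hS : AddsUserAt v S S')
    (hv : 1 ≤ (S'.items v).card ∧ ((S'.items v).card : ℝ) ≤ dmax) (i : Item) :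
    rerouteWeight τ dmax S' i - rerouteWeight τ dmax S i =
      rerouteFactor dmax / dmax *
        ∑ u ∈ adaptiveUsers dmax S' with i ∈ S'.items u, excessGrowth τ dmax S S' u := by
  rw [rerouteWeight, rerouteWeight, hS.adaptiveUsers_eq_cons hv, Finset.sum_filter,
    Finset.sum_filter, Finset.sum_filter, Finset.sum_cons, Finset.sum_cons, hS.excessGrowth_new,
    mul_add, Finset.mul_sum, add_sub_assoc, ← Finset.sum_sub_distrib]
  congr 1
  · split_ifs <;> ring
  · refine Finset.sum_congr rfl fun u hu => ?_
    rw [excessGrowth, if_pos (adaptiveUsers_subset _ _ hu), hS.items_eq_of_adaptive u hu]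
    split_ifs <;> ring

/-- The total growth of the excesses is the initial weight of the new user that is truncated. -/
theorem AddsUserAt.sum_excessGrowth (hS : AddsUserAt v S S') (hτ : 0 ≤ τ)
    (hv : 1 ≤ (S'.items v).card ∧ ((S'.items v).card : ℝ) ≤ dmax) :
    ∑ u ∈ adaptiveUsers dmax S', excessGrowth τ dmax S S' u =
      ∑ j ∈ S'.items v, (1 / ((S'.items v).card : ℝ)
        - (truncWeight τ dmax S' j - truncWeight τ dmax S j)) := by
  classical
  set Δ : Item → ℝ := fun j => excessRatio τ dmax S' j - excessRatio τ dmax S j with hΔ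
  have hold : ∑ u ∈ adaptiveUsers dmax S, excessGrowth τ dmax S S' u =
      ∑ j ∈ S'.items v, initWeight dmax S j * Δ j := by
    have h1 : ∀ u ∈ adaptiveUsers dmax S, excessGrowth τ dmax S S' u =
        ∑ j ∈ S'.items v, (if j ∈ S.items u then 1 / ((S.items u).card : ℝ) else 0) * Δ j := by
      intro u hu
      rw [hS.excessGrowth_old hu, Finset.mul_sum]
      simp_rw [ite_mul, zero_mul]
      -- Ratios change only on the items of `v`, so the sum can run over those instead of the items
      -- of `u`; after exchanging sums, the factors `1 / |S_u|` add up to the initial weight.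
      rw [Finset.sum_ite_mem, Finset.inter_comm, ← Finset.sum_ite_mem]
      refine Finset.sum_congr rfl fun j _ => ?_
      split_ifs with h
      · rfl
      · rw [hS.excessRatio_eq hv h, sub_self, mul_zero]
    rw [Finset.sum_congr rfl h1, Finset.sum_comm]
    refine Finset.sum_congr rfl fun j _ => ?_
    rw [initWeight, Finset.sum_filter, Finset.sum_mul]
  rw [hS.adaptiveUsers_eq_cons hv, Finset.sum_cons, hS.excessGrowth_new, hold, userExcess,
    Finset.mul_sum, ← Finset.sum_add_distrib]
  refine Finset.sum_congr rfl fun j hj => ?_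
  -- With `w' = w + 1 / k`, the contribution of item `j` is `r' / k + w (r' - r) = w' r' - w r`, the
  -- growth of the amount cut off.
  have e1 := initWeight_mul_excessRatio hτ dmax S j
  have e2 := initWeight_mul_excessRatio hτ dmax S' j
  have e3 := hS.initWeight_eq hv j
  rw [if_pos hj] at e3
  simp only [hΔ]
  rw [e3] at e2
  linarith

-- The subtracted quantity `1 / k - (truncWeight' - truncWeight)` is the part of the initial weight
-- of `v` that truncation removes; it plays the role of `s` in `sum_sq_add_le_one`.
open Classical in
theorem AddsUserAt.unbiasedMAD_sub (hS : AddsUserAt v S S')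
    (hv : 1 ≤ (S'.items v).card ∧ ((S'.items v).card : ℝ) ≤ dmax) (i : Item) :
    unbiasedMAD τ dmax S' i - unbiasedMAD τ dmax S i =
      (if i ∈ S'.items v then 1 / √((S'.items v).card : ℝ) - (1 / ((S'.items v).card : ℝ)
        - (truncWeight τ dmax S' i - truncWeight τ dmax S i)) else 0)
      + (rerouteWeight τ dmax S' i - rerouteWeight τ dmax S i) := by
  rw [unbiasedMAD_eq, unbiasedMAD_eq, hS.basic_eq, hS.initWeight_eq hv]
  split_ifs with h
  · ring
  · rw [truncWeight, hS.initWeight_eq hv, if_neg h, truncWeight, zero_add]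
    ring

theorem AddsUserAt.sum_sq_unbiasedMAD_sub_le (hS : AddsUserAt v S S') (hτ : 0 ≤ τ)
    (hd : 1 < dmax) (V : Finset Item) :
    ∑ i ∈ V, (unbiasedMAD τ dmax S' i - unbiasedMAD τ dmax S i) ^ 2 ≤ 1 := by
  classical
  by_cases hv : 1 ≤ (S'.items v).card ∧ ((S'.items v).card : ℝ) ≤ dmax
  swap
  · simp_rw [hS.unbiasedMAD_sub_of_not τ hv, hS.basic_eq, add_sub_cancel_right]
    exact sum_ite_uniform_sq_le_one V (S'.items v)
  have hα0 : 0 < rerouteFactor dmax := by linarith [one_half_lt_rerouteFactor hd]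
  have hg0 := fun u hu => hS.excessGrowth_nonneg (u := u) hτ hv hu
  -- The norm estimate needs all items of `v` in the range; the added squares are nonnegative.
  refine (Finset.sum_le_sum_of_subset_of_nonneg (Finset.subset_union_left (s₂ := S'.items v))
    fun _ _ _ => sq_nonneg _).trans ?_
  simp_rw [hS.unbiasedMAD_sub hv]
  refine sum_sq_add_le_one hd Finset.subset_union_right (Finset.card_pos.1 hv.1) hv.2 ?_ ?_ ?_ ?_ ?_
  -- Truncation is 1-Lipschitz, so at most the full `1 / k` survives; its monotonicity gives the
  -- upper bound on `s` next.
  · intro i hi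
    have h1 := hS.initWeight_eq hv i
    rw [if_pos hi] at h1
    rw [truncWeight, truncWeight, h1]
    have : min (1 / ((S'.items v).card : ℝ) + initWeight dmax S i) τ ≤
        1 / ((S'.items v).card : ℝ) + min (initWeight dmax S i) τ := by
      rw [← min_add_add_left]
      exact min_le_min le_rfl (le_add_of_nonneg_left (by positivity))
    linarith
  · intro i _
    have : truncWeight τ dmax S i ≤ truncWeight τ dmax S' i :=
      min_le_min (hS.initWeight_le hv i) le_rfl
    linarith
  · intro i _
    rw [hS.rerouteWeight_sub hv]
    exact mul_nonneg (by positivity) (Finset.sum_nonneg fun u hu =>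
      hg0 u (Finset.mem_filter.1 hu).1)
  · intro i _
    rw [hS.rerouteWeight_sub hv, ← hS.sum_excessGrowth hτ hv, mul_div_right_comm]
    refine mul_le_mul_of_nonneg_left ?_ (by positivity)
    exact Finset.sum_le_sum_of_subset_of_nonneg (Finset.filter_subset _ _)
      fun u hu _ => hg0 u hu
  -- An adaptive user has at most `dmax` items, so it distributes at most `α` times its excess
  -- growth.
  · simp_rw [hS.rerouteWeight_sub hv, Finset.sum_filter]
    rw [← Finset.mul_sum, Finset.sum_comm, ← hS.sum_excessGrowth hτ hv]
    have h1 : ∑ u ∈ adaptiveUsers dmax S', ∑ i ∈ V ∪ S'.items v,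
        (if i ∈ S'.items u then excessGrowth τ dmax S S' u else 0) ≤
        ∑ u ∈ adaptiveUsers dmax S', dmax * excessGrowth τ dmax S S' u := by
      refine Finset.sum_le_sum fun u hu => ?_
      rw [Finset.sum_ite_mem, Finset.sum_const, nsmul_eq_mul]
      refine mul_le_mul_of_nonneg_right ?_ (hg0 u hu)
      refine le_trans ?_ (mem_adaptiveUsers.1 hu).2.2
      exact_mod_cast Finset.card_le_card Finset.inter_subset_right
    rw [← Finset.mul_sum] at h1
    refine (mul_le_mul_of_nonneg_left h1 (by positivity)).trans_eq ?_
    rw [← mul_assoc, div_mul_cancel₀ _ (by linarith)]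

-- Only `v` holds a novel item, whose initial weight `1 / k ≤ 1 ≤ τ` is untouched by truncation. Its
-- weight is therefore `1 / √k` plus the rerouted share `α e_v / dmax`.
open Classical in
theorem AddsUserAt.unbiasedMAD_novel_le (hS : AddsUserAt v S S') (hτ : 1 ≤ τ)
    (hd : 1 < dmax) {i : Item} (hi : i ∈ S'.items v \ S.union) :
    unbiasedMAD τ dmax S' i ≤ 1 / √((S'.items v \ S.union).card : ℝ) := by
  obtain ⟨hiv, hiS⟩ := Finset.mem_sdiff.1 hi
  have h0 : unbiasedMAD τ dmax S i = 0 := by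
    rw [unbiasedMAD_eq, truncWeight, rerouteWeight_eq_zero _ _ hiS, initWeight_eq_zero _ hiS,
      basic_eq_zero hiS, min_eq_left (by linarith)]
    ring
  by_cases hv : 1 ≤ (S'.items v).card ∧ ((S'.items v).card : ℝ) ≤ dmax
  swap
  · have h1 := hS.unbiasedMAD_sub_of_not τ hv i
    rw [h0, hS.basic_novel hi, basic_eq_zero hiS, sub_zero, sub_zero] at h1
    rw [h1]
    exact one_div_sqrt_card_le hi
  have hk : (1 : ℝ) ≤ (S'.items v).card := by exact_mod_cast hv.1
  have hα0 : 0 < rerouteFactor dmax := by linarith [one_half_lt_rerouteFactor hd]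
  have hinit : ∀ j ∈ S'.items v \ S.union,
      initWeight dmax S' j = 1 / ((S'.items v).card : ℝ) := fun j hj => by
    rw [hS.initWeight_eq hv, if_pos (Finset.mem_sdiff.1 hj).1,
      initWeight_eq_zero _ (Finset.mem_sdiff.1 hj).2, add_zero]
  have hle : 1 / ((S'.items v).card : ℝ) ≤ τ := by
    refine le_trans ?_ hτ
    rw [div_le_one (by linarith)]
    exact hk
  have hre : rerouteWeight τ dmax S' i = rerouteFactor dmax / dmax * userExcess τ dmax S' v := by
    have h1 := hS.rerouteWeight_sub (τ := τ) hv i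
    rw [rerouteWeight_eq_zero _ _ hiS, sub_zero, hS.adaptiveUsers_eq_cons hv, Finset.sum_filter,
      Finset.sum_cons, if_pos hiv, hS.excessGrowth_new, Finset.sum_eq_zero, add_zero] at h1
    · exact h1
    · intro u hu
      rw [if_neg]
      rw [hS.items_eq_of_adaptive u hu]
      exact fun h => hiS (Finset.mem_biUnion.2 ⟨u, adaptiveUsers_subset _ _ hu, h⟩)
  -- Novel items have excess ratio `0`; each of the remaining `k - t` has ratio at most `1`.
  have hex : userExcess τ dmax S' v ≤
      (((S'.items v).card : ℝ) - (S'.items v \ S.union).card) / (S'.items v).card := by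
    rw [userExcess, one_div_mul_eq_div]
    refine div_le_div_of_nonneg_right ?_ (by linarith)
    rw [← Finset.sum_sdiff (Finset.sdiff_subset (s := S'.items v) (t := S.union)),
      Finset.sum_eq_zero (s := S'.items v \ S.union), add_zero]
    · refine (Finset.sum_le_sum fun j _ => excessRatio_le_one (by linarith) _ _ _).trans_eq ?_
      rw [Finset.sum_const, nsmul_eq_mul, mul_one, Finset.cast_card_sdiff Finset.sdiff_subset]
    · exact fun j hj => excessRatio_eq_zero ((hinit j hj).trans_le hle)
  have ht : (1 : ℝ) ≤ (S'.items v \ S.union).card := by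
    exact_mod_cast Finset.card_pos.2 ⟨i, hi⟩
  have htk : ((S'.items v \ S.union).card : ℝ) ≤ (S'.items v).card := by
    exact_mod_cast Finset.card_le_card Finset.sdiff_subset
  refine le_trans ?_ (one_div_sqrt_add_le ht htk hv.2 hd)
  rw [unbiasedMAD_eq, truncWeight, hinit i hi, min_eq_left hle, hS.basic_novel hi, hre,
    mul_div_right_comm]
  have := mul_le_mul_of_nonneg_left hex (by positivity : 0 ≤ rerouteFactor dmax / dmax)
  linarith

end

end PartitionSelection

theorem corollary5p2 {User Item : Type*} (ε δ : ℝ) (hε : 0 < ε) (hδ : 0 < δ) (hδ' : δ ≤ 1)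
    (Δ₀ : ℕ) (hΔ₀ : 1 ≤ Δ₀) (dmax : ℝ) (hdmax : 1 < dmax) (β : ℝ) (hβ : 0 ≤ β)
    (h : ℕ → ℝ) (hh : h = fun t : ℕ => 1 / √(t : ℝ))
    (σ ρ : ℝ) (hσ : PartitionSelection.IsGaussianScale ε (δ / 2) 1 σ)
    (hρ : ρ = PartitionSelection.threshold h δ Δ₀ σ) :
    PartitionSelection.IsDP ε δ
        (PartitionSelection.weightAndThreshold (User := User) (Item := Item)
          (PartitionSelection.unbiasedMAD (ρ + β * σ) dmax) h δ Δ₀ σ) ∧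
      PartitionSelection.IsDP ε δ
        (PartitionSelection.weightAndThreshold (User := User) (Item := Item)
          PartitionSelection.basic h δ Δ₀ σ) := by
  classical
  have hρ1 : 1 ≤ ρ := by
    have h1 := PartitionSelection.le_threshold_one h hδ' hΔ₀ hσ.1
    rw [← hρ, hh] at h1
    simpa using h1
  have hτ : 1 ≤ ρ + β * σ := by linarith [mul_nonneg hβ hσ.1.le]
  constructor
  · refine PartitionSelection.isDP_weightAndThreshold _ hδ hδ' hσ Δ₀ ?_ ?_
    · exact fun v D D' hD => hD.sum_sq_unbiasedMAD_sub_le (by linarith) hdmax D.union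
    · intro v D D' hD i hi
      rw [hh]
      exact hD.unbiasedMAD_novel_le hτ hdmax hi
  · refine PartitionSelection.isDP_weightAndThreshold _ hδ hδ' hσ Δ₀ ?_ ?_
    · intro v D D' hD
      simp_rw [hD.basic_eq, add_sub_cancel_right]
      exact PartitionSelection.sum_ite_uniform_sq_le_one D.union (D'.items v)
    · intro v D D' hD i hi
      rw [hD.basic_novel hi, hh]
      exact PartitionSelection.one_div_sqrt_card_le hi
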